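/- **Setting.** Let $\hat G$ be a finite group with a homomorphism $\pi:\hat G\to\{\pm1\}$, let $\hat H\le\hat G$ be a subgroup on which $\pi$ is still surjective, and put $G=\ker\pi$, $H=\hat H\cap G$. Let $k$ be a field in which $2|H|$ is invertible, and let $\hat\alpha:\hat G^3\to k^\times$ be a normalized $3$-cocycle with coefficients in $k^\times_\pi$, i.e. $\hat\alpha([\omega_3|\omega_2|\omega_1])=1$ if some $\omega_i=e$ and $$\hat\alpha([\omega_3|\omega_2|\omega_1])^{\pi(\omega_4)}\,\hat\alpha([\omega_4|\omega_3\omega_2|\omega_1])\,\hat\alpha([\omega_4|\omega_3|\omega_2])=\hat\alpha([\omega_4\omega_3|\omega_2|\omega_1])\,\hat\alpha([\omega_4|\omega_3|\omega_2\omega_1]).$$ For a $k$-linear category $V$ write ${}^{1}V=V$, ${}^{-1}V=V^{\mathrm{op}}$, and similarly for functors and natural transformations. **Real representations.** A linear Real representation $\rho$ on $V$ of the categorical group determined by $(\hat G,\hat\alpha)$, i.e. an $\hat\alpha$-twisted Real $2$-representation, consists of $k$-linear equivalences $\rho(\omega):{}^{\pi(\omega)}V\to V$ for $\omega\in\hat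 G$, natural isomorphisms $\psi_{\omega_2,\omega_1}:\rho(\omega_2)\circ{}^{\pi(\omega_2)}\rho(\omega_1)\Rightarrow\rho(\omega_2\omega_1)$ and $\psi_e:\rho(e)\Rightarrow 1_V$ with $$\hat\alpha([\omega_3|\omega_2|\omega_1])\;\psi_{\omega_3\omega_2,\omega_1}\,(\psi_{\omega_3,\omega_2}\circ\rho(\omega_1))=\psi_{\omega_3,\omega_2\omega_1}\,(\rho(\omega_3)\circ{}^{\pi(\omega_3)}\psi_{\omega_2,\omega_1}^{\pi(\omega_3)}),$$ $\psi_{e,\omega}=\psi_e\circ\rho(\omega)$ and $\psi_{\omega,e}=\rho(\omega)\circ{}^{\pi(\omega)}\psi_e^{\pi(\omega)}$. **Real $2$-characters.** For $g\in G$ let $\mathbb{T}\mathrm{r}_\rho(g)$ be the vector space of natural transformations $1_V\Rightarrow\rho(g)$. For $\omega\in\hat G$ and $g'=\omega g^{\pi(\omega)}\omega^{-1}$ let $\beta_{g,\omega}:\mathbb{T}\mathrm{r}_\rho(g)\to\mathbb{T}\mathrm{r}_\rho(g')$ send $\phi$ to the composition $$1\Rightarrow\rho(\omega)\circ{}^{\pi(\omega)}\rho(\omega^{-1})\Rightarrow\rho(\omega)\circ{}^{\pi(\omega)}\rho(g^{\pi(\omega)})\circ{}^{\pi(\omega)}\rho(\omega^{-1})\Rightarrow\rho(g')\circ\rho(\omega)\circ{}^{\pi(\omega)}\rho(\omega^{-1})\Rightarrow\rho(g'),$$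 where the first and last arrows are induced by $(\psi_e\psi_{\omega,\omega^{-1}})^{\mp1}$, the third by $\psi_{g',\omega}^{-1}\psi_{\omega,g^{\pi(\omega)}}$, and the second by $\phi$ if $\pi(\omega)=1$ and by the opposite of $\rho(g^{-1})\xrightarrow{\rho(g^{-1})\phi}\rho(g^{-1})\rho(g)\xrightarrow{\psi_e\psi_{g^{-1},g}}1$ if $\pi(\omega)=-1$. If all spaces $\mathbb{T}\mathrm{r}_\rho(g)$ are finite dimensional, the Real $2$-character of $\rho$ is $\chi_\rho(g,\omega)=\operatorname{tr}(\beta_{g,\omega})$, defined for $g\in G$, $\omega\in\hat G$ with $\omega g^{\pi(\omega)}=g\omega$. **Transgression.** Put $$\tau_\pi^{\mathrm{ref}}(\hat\alpha)([\omega_2|\omega_1]\gamma)=\hat\alpha([\gamma|\gamma^{-1}|\gamma])^{\delta}\left(\frac{\hat\alpha([\omega_1\gamma^{-\pi(\omega_1)}\omega_1^{-1}|\omega_1\gamma^{\pi(\omega_1)}\omega_1^{-1}|\omega_1])\,\hat\alpha([\omega_1|\gamma^{-\pi(\omega_1)}|\gamma^{\pi(\omega_1)}])}{\hat\alpha([\omega_1\gamma^{-\pi(\omega_1)}\omega_1^{-1}|\omega_1|\gamma^{\pi(\omega_1)}])}\right)^{\frac{\pi(\omega_2)-1}{2}}\frac{\hat\alpha([\omega_2|\omega_1|\gamma^{\pi(\omega_2\omega_1)}])\,\hat\alpha([\omega_2\omega_1\gamma^{\pi(\omega_2\omega_1)}(\omega_2\omega_1)^{-1}|\omega_2|\omega_1])}{\hat\alpha([\omega_2|\omega_1\gamma^{\pi(\omega_2\omega_1)}\omega_1^{-1}|\omega_1])},$$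 where $\delta=1$ if $\pi(\omega_1)=\pi(\omega_2)=-1$ and $\delta=0$ otherwise, and, for $\omega g^{\pi(\omega)}=g\omega$ and $\sigma\in\hat G$, $$\tau\tau_\pi^{\mathrm{ref}}(\hat\alpha)([\sigma]g\xrightarrow{\omega}g)=\frac{\tau_\pi^{\mathrm{ref}}(\hat\alpha)([\sigma\omega\sigma^{-1}|\sigma]g)}{\tau_\pi^{\mathrm{ref}}(\hat\alpha)([\sigma|\omega]g)}.$$ **Real $2$-induction.** Let $\rho$ be a linear Real representation, on a $k$-linear category $V$, of the categorical group determined by $(\hat H,\hat\alpha|_{\hat H})$. Choose representatives $\sigma_1,\dots,\sigma_q$ of $\hat G/\hat H$. Then $\mathrm{RInd}(\rho)$ is the linear Real representation, for $(\hat G,\hat\alpha)$, on the category $\prod_{i=1}^q{}^{\pi(\sigma_i)}V$ in which $\omega\in\hat G$ acts by the matrix of functors whose $(j,i)$ entry is ${}^{\pi(\sigma_j)}\rho(\eta)$ if $\omega\sigma_i=\sigma_j\eta$ with $\eta\in\hat H$ and $0$ otherwise; its $2$-isomorphism $\psi_{\omega_2,\omega_1}$ has, for $\omega_1\sigma_i=\sigma_j\eta_1$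 and $\omega_2\sigma_j=\sigma_k\eta_2$ with $\eta_1,\eta_2\in\hat H$, the $(k,i)$ entry $$\frac{\hat\alpha([\omega_2|\sigma_j|\eta_1])}{\hat\alpha([\omega_2|\omega_1|\sigma_i])\,\hat\alpha([\sigma_k|\eta_2|\eta_1])}\cdot{}^{\pi(\sigma_k)}\psi^{\pi(\sigma_k)}_{\eta_2,\eta_1},$$ and its $\psi_e$ has the entries ${}^{\pi(\sigma_i)}\psi_e^{\pi(\sigma_i)}$. **Theorem.** Assume that $\mathbb{T}\mathrm{r}_\rho(h)$ is finite dimensional for all $h\in H$. Then the spaces $\mathbb{T}\mathrm{r}_{\mathrm{RInd}(\rho)}(g)$, $g\in G$, are finite dimensional, and for all $g\in G$ and $\omega\in\hat G$ with $\omega g^{\pi(\omega)}=g\omega$, $$\chi_{\mathrm{RInd}(\rho)}(g,\omega)=\frac{1}{2|H|}\sum_{\substack{\sigma\in\hat G\\ \sigma g^{\pi(\sigma)}\sigma^{-1},\;\sigma\omega\sigma^{-1}\in\hat H}}\tau\tau_\pi^{\mathrm{ref}}(\hat\alpha)([\sigma]g\xrightarrow{\omega}g)^{-1}\cdot\chi_\rho(\sigma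 g^{\pi(\sigma)}\sigma^{-1},\sigma\omega\sigma^{-1}).$$ -/

import Mathlib

open CategoryTheory

namespace Real2

universe v u

/-- The category `^ε C`: it is `C` for `ε = 1` and the opposite category for `ε = -1`.
Objects are those of `C`. -/
@[ext]
structure Signed (ε : ℤˣ) (C : Type u) : Type u where
  /-- the underlying object of `C` -/
  of : C

/-- Morphisms of `^ε C`. Exactly one of the two components has a true premise, so that a morphism
`x ⟶ y` of `^ε C` is a morphism `x ⟶ y` of `C` if `ε = 1` and a morphism `y ⟶ x` of `C` if
`ε = -1`. -/
@[ext]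
structure SignedHom {ε : ℤˣ} {C : Type u} [Category.{v} C] (x y : Signed ε C) : Type v where
  /-- the morphism if `ε = 1` -/
  pos : ε = 1 → (x.of ⟶ y.of)
  /-- the morphism if `ε = -1` -/
  neg : ε = -1 → (y.of ⟶ x.of)

namespace Signed

variable {γ δ ε : ℤˣ} {C : Type*} [Category* C] {D : Type*} [Category* D]

instance : Category (Signed ε C) where
  Hom x y := SignedHom x y
  id x := ⟨fun _ => 𝟙 x.of, fun _ => 𝟙 x.of⟩
  comp f g := ⟨fun h => f.pos h ≫ g.pos h, fun h => g.neg h ≫ f.neg h⟩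
  id_comp _ := by ext <;> simp
  comp_id _ := by ext <;> simp
  assoc _ _ _ := by ext <;> simp

@[ext] lemma hom_ext {x y : Signed ε C} {f g : x ⟶ y} (hp : ∀ h, f.pos h = g.pos h)
    (hn : ∀ h, f.neg h = g.neg h) : f = g :=
  SignedHom.ext (funext hp) (funext hn)

@[simp] lemma id_pos (x : Signed ε C) (h : ε = 1) : (𝟙 x : x ⟶ x).pos h = 𝟙 x.of := rfl
@[simp] lemma id_neg (x : Signed ε C) (h : ε = -1) : (𝟙 x : x ⟶ x).neg h = 𝟙 x.of := rfl
@[simp] lemma comp_pos {x y z : Signed ε C} (f : x ⟶ y) (g : y ⟶ z) (h : ε = 1) :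
    (f ≫ g).pos h = f.pos h ≫ g.pos h := rfl
@[simp] lemma comp_neg {x y z : Signed ε C} (f : x ⟶ y) (g : y ⟶ z) (h : ε = -1) :
    (f ≫ g).neg h = g.neg h ≫ f.neg h := rfl

section Linear

variable [Preadditive C]

instance (x y : Signed ε C) : Zero (x ⟶ y) := ⟨⟨fun _ => 0, fun _ => 0⟩⟩
instance (x y : Signed ε C) : Add (x ⟶ y) :=
  ⟨fun f g => ⟨fun h => f.pos h + g.pos h, fun h => f.neg h + g.neg h⟩⟩
instance (x y : Signed ε C) : Neg (x ⟶ y) := ⟨fun f => ⟨fun h => -f.pos h, fun h => -f.neg h⟩⟩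

@[simp] lemma hom_zero_pos {x y : Signed ε C} (h : ε = 1) : (0 : x ⟶ y).pos h = 0 := rfl
@[simp] lemma hom_zero_neg {x y : Signed ε C} (h : ε = -1) : (0 : x ⟶ y).neg h = 0 := rfl
@[simp] lemma hom_add_pos {x y : Signed ε C} (f g : x ⟶ y) (h : ε = 1) :
    (f + g).pos h = f.pos h + g.pos h := rfl
@[simp] lemma hom_add_neg {x y : Signed ε C} (f g : x ⟶ y) (h : ε = -1) :
    (f + g).neg h = f.neg h + g.neg h := rfl
@[simp] lemma hom_neg_pos {x y : Signed ε C} (f : x ⟶ y) (h : ε = 1) :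
    (-f).pos h = -f.pos h := rfl
@[simp] lemma hom_neg_neg {x y : Signed ε C} (f : x ⟶ y) (h : ε = -1) :
    (-f).neg h = -f.neg h := rfl

instance (x y : Signed ε C) : AddCommGroup (x ⟶ y) where
  add_assoc _ _ _ := by ext <;> simp [add_assoc]
  zero_add _ := by ext <;> simp
  add_zero _ := by ext <;> simp
  neg_add_cancel _ := by ext <;> simp
  add_comm _ _ := by ext <;> simp [add_comm]
  nsmul := nsmulRec
  zsmul := zsmulRec

instance : Preadditive (Signed ε C) where
  add_comp _ _ _ _ _ _ := by ext <;> simp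
  comp_add _ _ _ _ _ _ := by ext <;> simp

variable {R : Type*} [Semiring R] [Linear R C]

instance (x y : Signed ε C) : SMul R (x ⟶ y) :=
  ⟨fun r f => ⟨fun h => r • f.pos h, fun h => r • f.neg h⟩⟩

@[simp] lemma hom_smul_pos {x y : Signed ε C} (r : R) (f : x ⟶ y) (h : ε = 1) :
    (r • f).pos h = r • f.pos h := rfl
@[simp] lemma hom_smul_neg {x y : Signed ε C} (r : R) (f : x ⟶ y) (h : ε = -1) :
    (r • f).neg h = r • f.neg h := rfl

instance (x y : Signed ε C) : Module R (x ⟶ y) where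
  one_smul _ := by ext <;> simp
  mul_smul _ _ _ := by ext <;> simp [mul_smul]
  smul_zero _ := by ext <;> simp
  smul_add _ _ _ := by ext <;> simp
  add_smul _ _ _ := by ext <;> simp [add_smul]
  zero_smul _ := by ext <;> simp

instance : Linear R (Signed ε C) where
  smul_comp _ _ _ _ _ _ := by ext <;> simp
  comp_smul _ _ _ _ _ _ := by ext <;> simp

end Linear

/-- The isomorphism of `^ε C` from `x` to `y` induced by an isomorphism `e : x ≅ y` of `C`: it is
`e` if `ε = 1` and the inverse of `e`, read in the opposite category, if `ε = -1`. -/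
@[simps]
def iso (ε : ℤˣ) {x y : C} (e : x ≅ y) : (⟨x⟩ : Signed ε C) ≅ ⟨y⟩ where
  hom := ⟨fun _ => e.hom, fun _ => e.inv⟩
  inv := ⟨fun _ => e.inv, fun _ => e.hom⟩
  hom_inv_id := by ext <;> simp
  inv_hom_id := by ext <;> simp

/-- The identification `C = ^ε C` for `ε = 1`, on morphisms. -/
@[simps]
def ofOne (h : ε = 1) {x y : C} (f : x ⟶ y) : (⟨x⟩ : Signed ε C) ⟶ ⟨y⟩ where
  pos _ := f
  neg h' := absurd (h.symm.trans h') (by decide)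

lemma ofOne_id (h : ε = 1) (x : C) : ofOne h (𝟙 x) = 𝟙 _ := by
  ext h' <;> [rfl; exact absurd (h.symm.trans h') (by decide)]

lemma ofOne_comp (h : ε = 1) {x y z : C} (f : x ⟶ y) (g : y ⟶ z) :
    ofOne h (f ≫ g) = ofOne h f ≫ ofOne h g := by
  ext h' <;> [rfl; exact absurd (h.symm.trans h') (by decide)]

lemma ofOne_add [Preadditive C] (h : ε = 1) {x y : C} (f g : x ⟶ y) :
    ofOne h (f + g) = ofOne h f + ofOne h g := by
  ext h' <;> [rfl; exact absurd (h.symm.trans h') (by decide)]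

lemma ofOne_smul {R : Type*} [Semiring R] [Preadditive C] [Linear R C] (h : ε = 1) {x y : C}
    (r : R) (f : x ⟶ y) : ofOne h (r • f) = r • ofOne h f := by
  ext h' <;> [rfl; exact absurd (h.symm.trans h') (by decide)]

lemma mul_pp (h : γ = δ * ε) (h₁ : δ = 1) (h₂ : ε = 1) : γ = 1 := by
  subst h h₁ h₂; rfl
lemma mul_pn (h : γ = δ * ε) (h₁ : δ = 1) (h₂ : ε = -1) : γ = -1 := by
  subst h h₁ h₂; rfl
lemma mul_np (h : γ = δ * ε) (h₁ : δ = -1) (h₂ : ε = 1) : γ = -1 := by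
  subst h h₁ h₂; rfl
lemma mul_nn (h : γ = δ * ε) (h₁ : δ = -1) (h₂ : ε = -1) : γ = 1 := by
  subst h h₁ h₂; rfl

/-- The functor `^δ F : ^γ C = ^δ (^ε C) ⥤ ^δ D` induced by `F : ^ε C ⥤ D` for `γ = δ ε`, on
morphisms. -/
@[simps]
def push (F : Signed ε C ⥤ D) (h : γ = δ * ε) {x y : C} (f : (⟨x⟩ : Signed γ C) ⟶ ⟨y⟩) :
    (⟨F.obj ⟨x⟩⟩ : Signed δ D) ⟶ ⟨F.obj ⟨y⟩⟩ where
  pos h₁ := F.map (X := ⟨x⟩) (Y := ⟨y⟩)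
    ⟨fun h₂ => f.pos (mul_pp h h₁ h₂), fun h₂ => f.neg (mul_pn h h₁ h₂)⟩
  neg h₁ := F.map (X := ⟨y⟩) (Y := ⟨x⟩)
    ⟨fun h₂ => f.neg (mul_np h h₁ h₂), fun h₂ => f.pos (mul_nn h h₁ h₂)⟩

lemma push_id (F : Signed ε C ⥤ D) (h : γ = δ * ε) (x : C) :
    push F h (𝟙 (⟨x⟩ : Signed γ C)) = 𝟙 (⟨F.obj ⟨x⟩⟩ : Signed δ D) := by
  ext <;> exact F.map_id _

lemma push_comp (F : Signed ε C ⥤ D) (h : γ = δ * ε) {x y z : C}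
    (f : (⟨x⟩ : Signed γ C) ⟶ ⟨y⟩) (g : (⟨y⟩ : Signed γ C) ⟶ ⟨z⟩) :
    push F h (f ≫ g) = push F h f ≫ push F h g := by
  ext <;> refine Eq.trans ?_ (F.map_comp _ _) <;> rfl

lemma push_add [Preadditive C] [Preadditive D] (F : Signed ε C ⥤ D) [F.Additive]
    (h : γ = δ * ε) {x y : C} (f g : (⟨x⟩ : Signed γ C) ⟶ ⟨y⟩) :
    push F h (f + g) = push F h f + push F h g := by
  ext <;> refine Eq.trans ?_ F.map_add <;> rfl

lemma push_smul {R : Type*} [Semiring R] [Preadditive C] [Linear R C] [Preadditive D]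
    [Linear R D] (F : Signed ε C ⥤ D) [F.Linear R]
    (h : γ = δ * ε) {x y : C} (r : R) (f : (⟨x⟩ : Signed γ C) ⟶ ⟨y⟩) :
    push F h (r • f) = r • push F h f := by
  ext <;> refine Eq.trans ?_ (F.map_smul (R := R) _ _) <;> rfl

lemma push_iso (F : Signed ε C ⥤ D) (h : γ = δ * ε) {x y : C} (e : x ≅ y) :
    push F h (iso γ e).hom = (iso δ (F.mapIso (iso ε e))).hom := by
  ext <;> rfl

end Signed

section Scalars

variable {k : Type*} [CommRing k] {C : Type*} [Category* C] [Preadditive C] [Linear k C]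

/-- The isomorphism `c · e`. -/
@[simps]
def smulIso (c : kˣ) {x y : C} (e : x ≅ y) : x ≅ y where
  hom := (c : k) • e.hom
  inv := ((c⁻¹ : kˣ) : k) • e.inv
  hom_inv_id := by simp [smul_smul]
  inv_hom_id := by simp [smul_smul]

lemma iso_smulIso (ε : ℤˣ) (c : kˣ) {x y : C} (e : x ≅ y) :
    Signed.iso ε (smulIso c e) = smulIso (c ^ (ε : ℤ)) (Signed.iso ε e) := by
  ext h <;> simp [h]

end Scalars

section Rep

variable {G : Type*} [Group G]

/-- A normalized `3`-cocycle on `G` with coefficients in `kˣ`, on which `ω` acts by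
`a ↦ a ^ π(ω)`. -/
structure TwistedCocycle (π : G →* ℤˣ) (k : Type*) [CommRing k] where
  /-- the value on the simplex `[ω₃ | ω₂ | ω₁]` -/
  val : G → G → G → kˣ
  cocycle : ∀ ω₄ ω₃ ω₂ ω₁, val ω₃ ω₂ ω₁ ^ (π ω₄ : ℤ) * val ω₄ (ω₃ * ω₂) ω₁ * val ω₄ ω₃ ω₂ =
    val (ω₄ * ω₃) ω₂ ω₁ * val ω₄ ω₃ (ω₂ * ω₁)
  one_left : ∀ ω₂ ω₁, val 1 ω₂ ω₁ = 1
  one_mid : ∀ ω₂ ω₁, val ω₂ 1 ω₁ = 1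
  one_right : ∀ ω₂ ω₁, val ω₂ ω₁ 1 = 1

/-- The restriction of the grading to a subgroup. -/
abbrev resGrading (π : G →* ℤˣ) (H : Subgroup G) : H →* ℤˣ := π.comp H.subtype

/-- The restriction of a cocycle to a subgroup. -/
@[simps]
def TwistedCocycle.res {π : G →* ℤˣ} {k : Type*} [CommRing k] (α : TwistedCocycle π k)
    (H : Subgroup G) : TwistedCocycle (resGrading π H) k where
  val a b c := α.val a b c
  cocycle _ _ _ _ := α.cocycle _ _ _ _
  one_left _ _ := α.one_left _ _
  one_mid _ _ := α.one_mid _ _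
  one_right _ _ := α.one_right _ _

/-- The identity `F a x = F b y` for equal group elements `a`, `b` and equal objects `x`, `y`. -/
def castIso {π : G →* ℤˣ} {V : Type*} [Category* V] (F : ∀ ω : G, Signed (π ω) V ⥤ V)
    {a b : G} (h : a = b) {x y : V} (hxy : x = y) : (F a).obj ⟨x⟩ ≅ (F b).obj ⟨y⟩ :=
  eqToIso (by subst h hxy; rfl)

/-- An `α`-twisted Real `2`-representation on the `k`-linear category `V`, an object of the
`2`-category of `k`-linear categories with the duality involution `V ↦ Vᵒᵖ`.
Each `F ω` is an equivalence because of `ψ` and `ψe`. -/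
structure TwistedRep {π : G →* ℤˣ} {k : Type*} [CommRing k] (α : TwistedCocycle π k)
    (V : Type*) [Category* V] [Preadditive V] [Linear k V] where
  /-- the functors `ρ(ω) : ^π(ω) V ⥤ V` -/
  F : ∀ ω : G, Signed (π ω) V ⥤ V
  additive : ∀ ω, (F ω).Additive
  linear : ∀ ω, (F ω).Linear k
  /-- the components of the `2`-isomorphisms `ψ_{ω₂, ω₁} : ρ(ω₂) ∘ ^π(ω₂) ρ(ω₁) ≅ ρ(ω₂ ω₁)` -/
  ψ : ∀ (ω₂ ω₁ : G) (x : V), (F ω₂).obj ⟨(F ω₁).obj ⟨x⟩⟩ ≅ (F (ω₂ * ω₁)).obj ⟨x⟩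
  /-- the naturality of `ψ_{ω₂, ω₁}` -/
  ψ_nat : ∀ (ω₂ ω₁ : G) {x y : V} (f : (⟨x⟩ : Signed (π (ω₂ * ω₁)) V) ⟶ ⟨y⟩),
    (F ω₂).map (Signed.push (F ω₁) (π.map_mul ω₂ ω₁) f) ≫ (ψ ω₂ ω₁ y).hom =
      (ψ ω₂ ω₁ x).hom ≫ (F (ω₂ * ω₁)).map f
  /-- the components of the `2`-isomorphism `ψ_e : ρ(e) ≅ 1_V` -/
  ψe : ∀ x : V, (F 1).obj ⟨x⟩ ≅ x
  /-- the naturality of `ψ_e` -/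
  ψe_nat : ∀ {x y : V} (f : x ⟶ y),
    (F 1).map (Signed.ofOne π.map_one f) ≫ (ψe y).hom = (ψe x).hom ≫ f
  /-- twisted associativity:
  `α([ω₃|ω₂|ω₁]) · ψ_{ω₃ω₂,ω₁} (ψ_{ω₃,ω₂} ∘ ρ(ω₁)) = ψ_{ω₃,ω₂ω₁} (ρ(ω₃) ∘ ψ_{ω₂,ω₁} ^ π(ω₃))` -/
  assoc : ∀ (ω₃ ω₂ ω₁ : G) (x : V),
    smulIso (α.val ω₃ ω₂ ω₁) (ψ ω₃ ω₂ ((F ω₁).obj ⟨x⟩) ≪≫ ψ (ω₃ * ω₂) ω₁ x) ≪≫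
        castIso F (mul_assoc ω₃ ω₂ ω₁) rfl =
      (F ω₃).mapIso (Signed.iso (π ω₃) (ψ ω₂ ω₁ x)) ≪≫ ψ ω₃ (ω₂ * ω₁) x
  /-- `ψ_{e,ω} = ψ_e ∘ ρ(ω)` -/
  unit_left : ∀ (ω : G) (x : V),
    ψ 1 ω x ≪≫ castIso F (one_mul ω) rfl = ψe ((F ω).obj ⟨x⟩)
  /-- `ψ_{ω,e} = ρ(ω) ∘ ψ_e ^ π(ω)` -/
  unit_right : ∀ (ω : G) (x : V),
    ψ ω 1 x ≪≫ castIso F (mul_one ω) rfl = (F ω).mapIso (Signed.iso (π ω) (ψe x))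

namespace TwistedRep

variable {π : G →* ℤˣ} {k : Type*} [CommRing k] {α : TwistedCocycle π k}
  {V : Type*} [Category* V] [Preadditive V] [Linear k V] (ρ : TwistedRep α V)

instance (ω : G) : (ρ.F ω).Additive := ρ.additive ω
instance (ω : G) : (ρ.F ω).Linear k := ρ.linear ω

/-- The endofunctor `ρ(g)` of `V` for an element `g` of degree `+1`, on morphisms. -/
def actMap (g : π.ker) {x y : V} (f : x ⟶ y) : (ρ.F g).obj ⟨x⟩ ⟶ (ρ.F g).obj ⟨y⟩ :=
  (ρ.F g).map (Signed.ofOne (MonoidHom.mem_ker.mp g.2) f)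

lemma actMap_comp (g : π.ker) {x y z : V} (f : x ⟶ y) (f' : y ⟶ z) :
    ρ.actMap g (f ≫ f') = ρ.actMap g f ≫ ρ.actMap g f' := by
  rw [actMap, Signed.ofOne_comp]; exact (ρ.F _).map_comp _ _

lemma actMap_add (g : π.ker) {x y : V} (f f' : x ⟶ y) :
    ρ.actMap g (f + f') = ρ.actMap g f + ρ.actMap g f' := by
  rw [actMap, Signed.ofOne_add]; exact (ρ.F _).map_add

lemma actMap_smul (g : π.ker) {x y : V} (c : k) (f : x ⟶ y) :
    ρ.actMap g (c • f) = c • ρ.actMap g f := by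
  rw [actMap, Signed.ofOne_smul]; exact (ρ.F _).map_smul _ _

/-- The endofunctor `ρ(g)` of `V` for an element `g` of degree `+1`. -/
@[simps]
def act (g : π.ker) : V ⥤ V where
  obj x := (ρ.F g).obj ⟨x⟩
  map f := ρ.actMap g f
  map_id _ := by rw [actMap, Signed.ofOne_id]; exact (ρ.F _).map_id _
  map_comp f f' := ρ.actMap_comp g f f'

/-- The categorical trace `Tr_ρ(g)`, the space of natural transformations from `1_V` to `ρ(g)`. -/
abbrev Tr (g : π.ker) := 𝟭 V ⟶ ρ.act g

/-- The value at `x` of an element of the categorical trace. -/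
def ev {g : π.ker} (φ : ρ.Tr g) (x : V) : x ⟶ (ρ.F g).obj ⟨x⟩ := φ.app x

lemma ev_naturality {g : π.ker} (φ : ρ.Tr g) {x y : V} (f : x ⟶ y) :
    f ≫ ρ.ev φ y = ρ.ev φ x ≫ ρ.actMap g f := φ.naturality f

/-- For `a b = 1`, the isomorphism `ψ_e ψ_{a,b}` from `ρ(a) ∘ ^π(a) ρ(b)` to the identity,
at the object `x`. -/
def cap {a b : G} (h : a * b = 1) (x : V) : (ρ.F a).obj ⟨(ρ.F b).obj ⟨x⟩⟩ ≅ x :=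
  ρ.ψ a b x ≪≫ castIso ρ.F h rfl ≪≫ ρ.ψe x

lemma castIso_naturality {a b : G} (h : a = b) {x y : V}
    (f : (⟨x⟩ : Signed (π a) V) ⟶ ⟨y⟩) (f' : (⟨x⟩ : Signed (π b) V) ⟶ ⟨y⟩)
    (hp : ∀ h h', f.pos h = f'.pos h') (hn : ∀ h h', f.neg h = f'.neg h') :
    (ρ.F a).map f ≫ (castIso ρ.F h rfl).hom = (castIso ρ.F h rfl).hom ≫ (ρ.F b).map f' := by
  subst h
  obtain rfl : f = f' := by ext h <;> [exact hp h h; exact hn h h]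
  simp [castIso]

lemma cap_naturality {a b : G} (h : a * b = 1) {x y : V} (f : x ⟶ y) :
    (ρ.F a).map (Signed.push (ρ.F b) (π.map_mul a b) (Signed.ofOne (by rw [h, π.map_one]) f)) ≫
      (ρ.cap h y).hom = (ρ.cap h x).hom ≫ f := by
  have h1 := ρ.ψ_nat a b (Signed.ofOne (by rw [h, π.map_one]) f)
  have h2 := ρ.ψe_nat f
  have h3 := ρ.castIso_naturality h (Signed.ofOne (by rw [h, π.map_one]) f)
    (Signed.ofOne π.map_one f) (fun _ _ => rfl)
    (fun h' h'' => absurd ((π.map_one).symm.trans h'') (by decide))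
  simp only [cap, Iso.trans_hom, Category.assoc]
  rw [reassoc_of% h1, reassoc_of% h3, h2]

/-- The value at `x` of the `2`-morphism `1 ⟶ ^π(ω) ρ(g ^ π(ω))` of `^π(ω) V` induced by
`φ : 1 ⟶ ρ(g)`. It is `φ` if `π(ω) = 1`. If `π(ω) = -1`, it is the transformation
`ρ(g⁻¹) ⟶ ρ(g⁻¹) ρ(g) ⟶ 1` of endofunctors of `V`, composed of `ρ(g⁻¹) φ` and `ψ_e ψ_{g⁻¹,g}`,
read in the opposite category. -/
def twist (ω : G) {g : π.ker} (φ : ρ.Tr g) (x : V) :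
    (⟨x⟩ : Signed (π ω) V) ⟶ ⟨(ρ.F ↑(g ^ (π ω : ℤ))).obj ⟨x⟩⟩ where
  pos h := ρ.ev φ x ≫ (castIso ρ.F (a := ↑g) (by simp [h]) rfl).hom
  neg h := (castIso ρ.F (b := ↑(g⁻¹)) (by simp [h]) rfl).hom ≫ ρ.actMap g⁻¹ (ρ.ev φ x) ≫
    (ρ.cap (a := ↑(g⁻¹)) (b := ↑g) (by simp) x).hom

/-- For `ω g ^ π(ω) = g' ω`, the composition
`ρ(ω) ⟶ ρ(ω) ∘ ^π(ω) ρ(g ^ π(ω)) ⟶ ρ(ω g ^ π(ω)) = ρ(g' ω) ⟶ ρ(g') ∘ ρ(ω)` at `y`. -/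
def slide {ω : G} {g g' : π.ker} (h : ω * ↑(g ^ (π ω : ℤ)) = ↑g' * ω) (φ : ρ.Tr g) (y : V) :
    (ρ.F ω).obj ⟨y⟩ ⟶ (ρ.F g').obj ⟨(ρ.F ω).obj ⟨y⟩⟩ :=
  (ρ.F ω).map (ρ.twist ω φ y) ≫ (ρ.ψ ω ↑(g ^ (π ω : ℤ)) y).hom ≫
    (castIso ρ.F h rfl).hom ≫ (ρ.ψ g' ω y).inv

lemma sign_coe (ω : G) (g : π.ker) : π ω = π ω * π (g : G) := by
  rw [MonoidHom.mem_ker.mp g.2, mul_one]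

lemma ker_ne (g : π.ker) : π (g : G) ≠ -1 := fun h =>
  absurd ((MonoidHom.mem_ker.mp g.2).symm.trans h) (by decide)

lemma push_ker {ε δ : ℤˣ} (g : π.ker) (h : ε = δ * π (g : G)) {x y : V}
    (f : (⟨x⟩ : Signed ε V) ⟶ ⟨y⟩) :
    Signed.push (ρ.F g) h f =
      ⟨fun h' => ρ.actMap g (f.pos (by rw [h, h', MonoidHom.mem_ker.mp g.2]; rfl)),
        fun h' => ρ.actMap g (f.neg (by rw [h, h', MonoidHom.mem_ker.mp g.2]; rfl))⟩ := by
  ext h'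
  · refine congrArg (ρ.F g).map ?_
    ext h'' <;> [rfl; exact absurd h'' (ker_ne _)]
  · refine congrArg (ρ.F g).map ?_
    ext h'' <;> [rfl; exact absurd h'' (ker_ne _)]

lemma castIso_actMap {g g' : π.ker} (h : (g : G) = g') {x y : V} (f : x ⟶ y) :
    ρ.actMap g f ≫ (castIso ρ.F h rfl).hom = (castIso ρ.F h rfl).hom ≫ ρ.actMap g' f :=
  ρ.castIso_naturality h _ _ (fun _ _ => rfl) (fun h' _ => absurd h' (ker_ne _))

lemma twist_naturality (ω : G) {g : π.ker} (φ : ρ.Tr g) {x y : V}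
    (f : (⟨x⟩ : Signed (π ω) V) ⟶ ⟨y⟩) :
    f ≫ ρ.twist ω φ y = ρ.twist ω φ x ≫
      Signed.push (ρ.F ↑(g ^ (π ω : ℤ))) (sign_coe ω (g ^ (π ω : ℤ))) f := by
  rw [push_ker]
  ext h
  · have h1 := ρ.ev_naturality φ (f.pos h)
    have h3 := ρ.castIso_actMap (g := g) (g' := g ^ (π ω : ℤ)) (by simp [h]) (f.pos h)
    simp only [twist, Signed.comp_pos, Category.assoc]
    rw [reassoc_of% h1, h3]
  · have h1 := ρ.ev_naturality φ (f.neg h)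
    have h3 := ρ.castIso_actMap (g := g ^ (π ω : ℤ)) (g' := g⁻¹) (by simp [h]) (f.neg h)
    have h4 := ρ.cap_naturality (a := ↑(g⁻¹)) (b := ↑g) (by simp) (f.neg h)
    have h6 : (ρ.F ↑(g⁻¹)).map (Signed.push (ρ.F ↑g) (π.map_mul _ _)
          (Signed.ofOne (by simp) (f.neg h))) = ρ.actMap g⁻¹ (ρ.actMap g (f.neg h)) := by
      rw [push_ker]
      refine congrArg (ρ.F ↑(g⁻¹)).map ?_
      ext h' <;> [rfl; exact absurd h' (ker_ne _)]
    rw [h6] at h4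
    have h5 : ρ.actMap g⁻¹ (f.neg h) ≫ ρ.actMap g⁻¹ (ρ.ev φ x) =
        ρ.actMap g⁻¹ (ρ.ev φ y) ≫ ρ.actMap g⁻¹ (ρ.actMap g (f.neg h)) := by
      rw [← actMap_comp, ← actMap_comp, h1]
    simp only [twist, Signed.comp_neg, Category.assoc]
    rw [reassoc_of% h3, reassoc_of% h5, h4]

lemma slide_naturality {ω : G} {g g' : π.ker} (h : ω * ↑(g ^ (π ω : ℤ)) = ↑g' * ω)
    (φ : ρ.Tr g) {x y : V} (f : (⟨x⟩ : Signed (π ω) V) ⟶ ⟨y⟩) :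
    (ρ.F ω).map f ≫ ρ.slide h φ y = ρ.slide h φ x ≫ ρ.actMap g' ((ρ.F ω).map f) := by
  have e1 : π (ω * ↑(g ^ (π ω : ℤ))) = π ω := by
    rw [map_mul, MonoidHom.mem_ker.mp (g ^ (π ω : ℤ)).2, mul_one]
  have e2 : π (↑g' * ω) = π ω := by rw [← h, e1]
  have h1 := congrArg (ρ.F ω).map (ρ.twist_naturality ω φ f)
  rw [Functor.map_comp, Functor.map_comp] at h1
  let f1 : (⟨x⟩ : Signed (π (ω * ↑(g ^ (π ω : ℤ)))) V) ⟶ ⟨y⟩ :=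
    ⟨fun h => f.pos (e1.symm.trans h), fun h => f.neg (e1.symm.trans h)⟩
  let f2 : (⟨x⟩ : Signed (π (↑g' * ω)) V) ⟶ ⟨y⟩ :=
    ⟨fun h => f.pos (e2.symm.trans h), fun h => f.neg (e2.symm.trans h)⟩
  have h2 := ρ.ψ_nat ω ↑(g ^ (π ω : ℤ)) f1
  have h3 := ρ.castIso_naturality h f1 f2 (fun _ _ => rfl) (fun _ _ => rfl)
  have h4 := ρ.ψ_nat ↑g' ω f2
  have h4' : (ρ.F (↑g' * ω)).map f2 ≫ (ρ.ψ g' ω y).inv = (ρ.ψ g' ω x).inv ≫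
      (ρ.F g').map (Signed.push (ρ.F ω) (π.map_mul _ _) f2) := by
    rw [Iso.comp_inv_eq, Category.assoc, h4, Iso.inv_hom_id_assoc]
  have h5 : ρ.actMap g' ((ρ.F ω).map f) =
      (ρ.F g').map (Signed.push (ρ.F ω) (π.map_mul _ _) f2) := by
    refine congrArg (ρ.F g').map ?_
    ext h'
    · rfl
    · exact absurd ((MonoidHom.mem_ker.mp g'.2).symm.trans h') (by decide)
  have h6 : (ρ.F ω).map (Signed.push (ρ.F ↑(g ^ (π ω : ℤ))) (sign_coe ω (g ^ (π ω : ℤ))) f) =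
      (ρ.F ω).map (Signed.push (ρ.F ↑(g ^ (π ω : ℤ))) (π.map_mul _ _) f1) := rfl
  rw [h5]
  unfold slide
  rw [reassoc_of% h1, h6, reassoc_of% h2, reassoc_of% h3, h4']
  simp

lemma ev_add {g : π.ker} (φ φ' : ρ.Tr g) (x : V) :
    ρ.ev (φ + φ') x = ρ.ev φ x + ρ.ev φ' x := rfl

lemma ev_smul {g : π.ker} (c : k) (φ : ρ.Tr g) (x : V) : ρ.ev (c • φ) x = c • ρ.ev φ x := rfl

lemma twist_add (ω : G) {g : π.ker} (φ φ' : ρ.Tr g) (x : V) :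
    ρ.twist ω (φ + φ') x = ρ.twist ω φ x + ρ.twist ω φ' x := by
  ext h <;> simp [twist, ev_add, actMap_add]

lemma twist_smul (ω : G) {g : π.ker} (c : k) (φ : ρ.Tr g) (x : V) :
    ρ.twist ω (c • φ) x = c • ρ.twist ω φ x := by
  ext h <;> simp [twist, ev_smul, actMap_smul]

lemma slide_add {ω : G} {g g' : π.ker} (h : ω * ↑(g ^ (π ω : ℤ)) = ↑g' * ω) (φ φ' : ρ.Tr g)
    (y : V) : ρ.slide h (φ + φ') y = ρ.slide h φ y + ρ.slide h φ' y := by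
  simp only [slide, twist_add, Functor.map_add, Preadditive.add_comp]

lemma slide_smul {ω : G} {g g' : π.ker} (h : ω * ↑(g ^ (π ω : ℤ)) = ↑g' * ω) (c : k)
    (φ : ρ.Tr g) (y : V) : ρ.slide h (c • φ) y = c • ρ.slide h φ y := by
  simp only [slide, twist_smul, Functor.map_smul, Linear.smul_comp]

lemma beta_naturality {ω : G} {g g' : π.ker} (h : ω * ↑(g ^ (π ω : ℤ)) = ↑g' * ω)
    (φ : ρ.Tr g) {x y : V} (f : x ⟶ y) :
    f ≫ (ρ.cap (mul_inv_cancel ω) y).inv ≫ ρ.slide h φ ((ρ.F ω⁻¹).obj ⟨y⟩) ≫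
        ρ.actMap g' (ρ.cap (mul_inv_cancel ω) y).hom =
      ((ρ.cap (mul_inv_cancel ω) x).inv ≫ ρ.slide h φ ((ρ.F ω⁻¹).obj ⟨x⟩) ≫
        ρ.actMap g' (ρ.cap (mul_inv_cancel ω) x).hom) ≫ ρ.actMap g' f := by
  have h1 := ρ.cap_naturality (mul_inv_cancel ω) f
  have h2 := ρ.slide_naturality h φ (Signed.push (ρ.F ω⁻¹) (π.map_mul ω ω⁻¹)
    (Signed.ofOne (by rw [mul_inv_cancel, π.map_one]) f))
  have h3 : f ≫ (ρ.cap (mul_inv_cancel ω) y).inv = (ρ.cap (mul_inv_cancel ω) x).inv ≫ _ :=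
    (Iso.comp_inv_eq _).mpr (((Iso.inv_comp_eq _).mpr h1).symm.trans
      (Category.assoc _ _ _).symm)
  rw [reassoc_of% h3, reassoc_of% h2, ← actMap_comp, h1, actMap_comp]
  simp only [Category.assoc]

/-- For `ω g ^ π(ω) = g' ω` and `φ : 1 ⟶ ρ(g)`, the value at `x` of the composition
`1 ⟶ ρ(ω) ∘ ^π(ω) ρ(ω⁻¹) ⟶ ρ(g') ∘ ρ(ω) ∘ ^π(ω) ρ(ω⁻¹) ⟶ ρ(g')`. -/
def betaApp {ω : G} {g g' : π.ker} (h : ω * ↑(g ^ (π ω : ℤ)) = ↑g' * ω) (φ : ρ.Tr g) (x : V) :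
    x ⟶ (ρ.F g').obj ⟨x⟩ :=
  (ρ.cap (mul_inv_cancel ω) x).inv ≫ ρ.slide h φ ((ρ.F ω⁻¹).obj ⟨x⟩) ≫
    ρ.actMap g' (ρ.cap (mul_inv_cancel ω) x).hom

lemma betaApp_naturality {ω : G} {g g' : π.ker} (h : ω * ↑(g ^ (π ω : ℤ)) = ↑g' * ω)
    (φ : ρ.Tr g) {x y : V} (f : x ⟶ y) :
    f ≫ ρ.betaApp h φ y = ρ.betaApp h φ x ≫ ρ.actMap g' f := by
  have h1 := ρ.cap_naturality (mul_inv_cancel ω) f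
  have h2 := ρ.slide_naturality h φ (Signed.push (ρ.F ω⁻¹) (π.map_mul ω ω⁻¹)
    (Signed.ofOne (by rw [mul_inv_cancel, π.map_one]) f))
  have h3 : f ≫ (ρ.cap (mul_inv_cancel ω) y).inv = (ρ.cap (mul_inv_cancel ω) x).inv ≫ _ :=
    (Iso.comp_inv_eq _).mpr (((Iso.inv_comp_eq _).mpr h1).symm.trans
      (Category.assoc _ _ _).symm)
  simp only [betaApp, Category.assoc]
  rw [reassoc_of% h3, reassoc_of% h2, ← actMap_comp, h1, actMap_comp]

lemma betaApp_add {ω : G} {g g' : π.ker} (h : ω * ↑(g ^ (π ω : ℤ)) = ↑g' * ω)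
    (φ φ' : ρ.Tr g) (x : V) :
    ρ.betaApp h (φ + φ') x = ρ.betaApp h φ x + ρ.betaApp h φ' x := by
  simp only [betaApp, slide_add, Preadditive.add_comp, Preadditive.comp_add]

lemma betaApp_smul {ω : G} {g g' : π.ker} (h : ω * ↑(g ^ (π ω : ℤ)) = ↑g' * ω)
    (c : k) (φ : ρ.Tr g) (x : V) : ρ.betaApp h (c • φ) x = c • ρ.betaApp h φ x := by
  simp only [betaApp, slide_smul, Linear.smul_comp, Linear.comp_smul]

/-- For `ω g ^ π(ω) = g' ω`, that is, `g' = ω g ^ π(ω) ω⁻¹`, the linear map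
`β_{g, ω} : Tr_ρ(g) ⟶ Tr_ρ(g')`. -/
def beta {ω : G} {g g' : π.ker} (h : ω * ↑(g ^ (π ω : ℤ)) = ↑g' * ω) :
    ρ.Tr g →ₗ[k] ρ.Tr g' where
  toFun φ := { app := ρ.betaApp h φ, naturality := fun _ _ f => ρ.betaApp_naturality h φ f }
  map_add' φ φ' := by ext x; exact ρ.betaApp_add h φ φ' x
  map_smul' c φ := by ext x; exact ρ.betaApp_smul h c φ x

end TwistedRep

/-- A graded commuting pair `(g, ω)`: `g` has degree `+1` and `ω g ^ π(ω) = g ω`. -/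
structure GComm (π : G →* ℤˣ) where
  /-- the element of degree `+1` -/
  g : π.ker
  /-- the element of arbitrary degree -/
  ω : G
  comm : ω * ↑(g ^ (π ω : ℤ)) = ↑g * ω

namespace GComm

variable {π : G →* ℤˣ}

/-- The pair `(σ g ^ π(σ) σ⁻¹, σ ω σ⁻¹)`. -/
def conj (p : GComm π) (σ : G) : GComm π where
  g := ⟨σ * ↑(p.g ^ (π σ : ℤ)) * σ⁻¹, by
    rw [MonoidHom.mem_ker, map_mul, map_mul, MonoidHom.mem_ker.mp (p.g ^ (π σ : ℤ)).2, mul_one,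
      map_inv, mul_inv_cancel]⟩
  ω := σ * p.ω * σ⁻¹
  comm := by
    have h := p.comm
    have hπ : π (σ * p.ω * σ⁻¹) = π p.ω := by
      rw [map_mul, map_mul, map_inv, mul_right_comm, mul_inv_cancel, one_mul]
    rw [hπ]
    push_cast at h ⊢
    have h' := SemiconjBy.zpow_right (a := p.ω) h (π σ : ℤ)
    rw [conj_zpow, ← zpow_mul, mul_comm, zpow_mul]
    calc _ = σ * (p.ω * ((p.g : G) ^ (π p.ω : ℤ)) ^ (π σ : ℤ)) * σ⁻¹ := by group
      _ = σ * ((p.g : G) ^ (π σ : ℤ) * p.ω) * σ⁻¹ := by rw [h'.eq]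
      _ = _ := by group

/-- The pair lies in the subgroup `H`. -/
def Mem (p : GComm π) (H : Subgroup G) : Prop := (p.g : G) ∈ H ∧ p.ω ∈ H

/-- A graded commuting pair of elements of `H`, as a graded commuting pair of the graded group
`H`. -/
def toSub (p : GComm π) {H : Subgroup G} (h : p.Mem H) : GComm (resGrading π H) where
  g := ⟨⟨p.g, h.1⟩, p.g.2⟩
  ω := ⟨p.ω, h.2⟩
  comm := by
    apply Subtype.ext
    have := p.comm
    push_cast at this ⊢
    exact this

end GComm

/-- The Real `2`-character `χ_ρ(g, ω)`, the trace of `β_{g, ω}` on `Tr_ρ(g)`. -/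
noncomputable def TwistedRep.chi {π : G →* ℤˣ} {k : Type*} [CommRing k] {α : TwistedCocycle π k}
    {V : Type*} [Category* V] [Preadditive V] [Linear k V] (ρ : TwistedRep α V) (p : GComm π) :
    k :=
  LinearMap.trace k (ρ.Tr p.g) (ρ.beta p.comm)

namespace TwistedCocycle

variable {π : G →* ℤˣ} {k : Type*} [CommRing k] (α : TwistedCocycle π k)

/-- The loop transgression of `α`, evaluated on `[ω₂ | ω₁] γ`. -/
def tauRef (ω₂ ω₁ γ : G) : kˣ :=
  (if π ω₂ = -1 ∧ π ω₁ = -1 then α.val γ γ⁻¹ γ else 1) *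
  (α.val (ω₁ * γ ^ (-π ω₁ : ℤ) * ω₁⁻¹) (ω₁ * γ ^ (π ω₁ : ℤ) * ω₁⁻¹) ω₁ *
      α.val ω₁ (γ ^ (-π ω₁ : ℤ)) (γ ^ (π ω₁ : ℤ)) /
      α.val (ω₁ * γ ^ (-π ω₁ : ℤ) * ω₁⁻¹) ω₁ (γ ^ (π ω₁ : ℤ))) ^ (((π ω₂ : ℤ) - 1) / 2) *
  (α.val ω₂ ω₁ (γ ^ (π (ω₂ * ω₁) : ℤ)) *
      α.val (ω₂ * ω₁ * γ ^ (π (ω₂ * ω₁) : ℤ) * (ω₂ * ω₁)⁻¹) ω₂ ω₁ /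
      α.val ω₂ (ω₁ * γ ^ (π (ω₂ * ω₁) : ℤ) * ω₁⁻¹) ω₁)

/-- The iterated transgression of `α`, evaluated on `[σ] (g ⟶ g)` for the loop given by `ω`. -/
def tautau (σ : G) (p : GComm π) : kˣ :=
  α.tauRef (σ * p.ω * σ⁻¹) σ p.g / α.tauRef σ p.ω p.g

end TwistedCocycle
end Rep

/-- The product category `∏ i, ^(ε i) V`. An object is a family of objects of `V`. -/
@[ext]
structure SProd {ι : Type*} (ε : ι → ℤˣ) (V : Type*) where
  /-- the underlying family of objects -/
  of : ι → V

/-- Morphisms of `∏ i, ^(ε i) V`: families of morphisms of the categories `^(ε i) V`. -/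
@[ext]
structure SProdHom {ι : Type*} {ε : ι → ℤˣ} {V : Type*} [Category* V] (x y : SProd ε V) where
  /-- the components -/
  app : ∀ i, (⟨x.of i⟩ : Signed (ε i) V) ⟶ ⟨y.of i⟩

namespace SProd

variable {ι : Type*} {ε : ι → ℤˣ} {V : Type*} [Category* V]

instance : Category (SProd ε V) where
  Hom x y := SProdHom x y
  id x := ⟨fun _ => 𝟙 _⟩
  comp f g := ⟨fun i => f.app i ≫ g.app i⟩
  id_comp _ := by ext : 2; exact Category.id_comp _
  comp_id _ := by ext : 2; exact Category.comp_id _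
  assoc _ _ _ := by ext : 2; exact Category.assoc _ _ _

lemma hom_ext {x y : SProd ε V} {f g : x ⟶ y} (h : ∀ i, f.app i = g.app i) : f = g :=
  SProdHom.ext (funext h)

@[simp] lemma id_at (x : SProd ε V) (i : ι) : (𝟙 x : x ⟶ x).app i = 𝟙 _ := rfl
@[simp] lemma comp_at {x y z : SProd ε V} (f : x ⟶ y) (g : y ⟶ z) (i : ι) :
    (f ≫ g).app i = f.app i ≫ g.app i := rfl

/-- The isomorphism of the product category with given components. -/
@[simps]
def iso {x y : SProd ε V} (e : ∀ i, (⟨x.of i⟩ : Signed (ε i) V) ≅ ⟨y.of i⟩) : x ≅ y where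
  hom := ⟨fun i => (e i).hom⟩
  inv := ⟨fun i => (e i).inv⟩
  hom_inv_id := hom_ext fun i => (e i).hom_inv_id
  inv_hom_id := hom_ext fun i => (e i).inv_hom_id

section Linear

variable [Preadditive V]

instance (x y : SProd ε V) : Zero (x ⟶ y) := ⟨⟨fun _ => 0⟩⟩
instance (x y : SProd ε V) : Add (x ⟶ y) := ⟨fun f g => ⟨fun i => f.app i + g.app i⟩⟩
instance (x y : SProd ε V) : Neg (x ⟶ y) := ⟨fun f => ⟨fun i => -f.app i⟩⟩

@[simp] lemma hom_zero_at {x y : SProd ε V} (i : ι) : (0 : x ⟶ y).app i = 0 := rfl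
@[simp] lemma hom_add_at {x y : SProd ε V} (f g : x ⟶ y) (i : ι) :
    (f + g).app i = f.app i + g.app i := rfl
@[simp] lemma hom_neg_at {x y : SProd ε V} (f : x ⟶ y) (i : ι) : (-f).app i = -f.app i := rfl

instance (x y : SProd ε V) : AddCommGroup (x ⟶ y) where
  add_assoc _ _ _ := hom_ext fun _ => add_assoc _ _ _
  zero_add _ := hom_ext fun _ => zero_add _
  add_zero _ := hom_ext fun _ => add_zero _
  neg_add_cancel _ := hom_ext fun _ => neg_add_cancel _
  add_comm _ _ := hom_ext fun _ => add_comm _ _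
  nsmul := nsmulRec
  zsmul := zsmulRec

instance : Preadditive (SProd ε V) where
  add_comp _ _ _ _ _ _ := hom_ext fun _ => Preadditive.add_comp _ _ _ _ _ _
  comp_add _ _ _ _ _ _ := hom_ext fun _ => Preadditive.comp_add _ _ _ _ _ _

variable {R : Type*} [Semiring R] [Linear R V]

instance (x y : SProd ε V) : SMul R (x ⟶ y) := ⟨fun r f => ⟨fun i => r • f.app i⟩⟩

@[simp] lemma hom_smul_at {x y : SProd ε V} (r : R) (f : x ⟶ y) (i : ι) :
    (r • f).app i = r • f.app i := rfl

instance (x y : SProd ε V) : Module R (x ⟶ y) where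
  one_smul _ := hom_ext fun _ => one_smul _ _
  mul_smul _ _ _ := hom_ext fun _ => mul_smul _ _ _
  smul_zero _ := hom_ext fun _ => smul_zero _
  smul_add _ _ _ := hom_ext fun _ => smul_add _ _ _
  add_smul _ _ _ := hom_ext fun _ => add_smul _ _ _
  zero_smul _ := hom_ext fun _ => zero_smul _ _

instance : Linear R (SProd ε V) where
  smul_comp _ _ _ _ _ _ := hom_ext fun _ => Linear.smul_comp _ _ _ _ _ _
  comp_smul _ _ _ _ _ _ := hom_ext fun _ => Linear.comp_smul _ _ _ _ _ _

end Linear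

/-- The projection `^δ (∏ i, ^(ε i) V) ⥤ ^δ (^(ε i) V) = ^γ V` for `γ = δ (ε i)`, on
morphisms. -/
def coord {γ δ : ℤˣ} {x y : SProd ε V} (f : (⟨x⟩ : Signed δ (SProd ε V)) ⟶ ⟨y⟩) (i : ι)
    (h : γ = δ * ε i) : (⟨x.of i⟩ : Signed γ V) ⟶ ⟨y.of i⟩ :=
  if h₁ : δ = 1 then
    ⟨fun hγ => ((f.pos h₁).app i).pos (by rw [h, h₁, one_mul] at hγ; exact hγ),
      fun hγ => ((f.pos h₁).app i).neg (by rw [h, h₁, one_mul] at hγ; exact hγ)⟩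
  else
    have h₂ : δ = -1 := (Int.units_eq_one_or δ).resolve_left h₁
    ⟨fun hγ => ((f.neg h₂).app i).neg (by
        rw [h, h₂, neg_one_mul, neg_eq_iff_eq_neg] at hγ; exact hγ),
      fun hγ => ((f.neg h₂).app i).pos (by rw [h, h₂, neg_one_mul, neg_inj] at hγ; exact hγ)⟩

lemma coord_pos {γ δ : ℤˣ} {x y : SProd ε V} (f : (⟨x⟩ : Signed δ (SProd ε V)) ⟶ ⟨y⟩) (i : ι)
    (h : γ = δ * ε i) (h₁ : δ = 1) : coord f i h =
    ⟨fun hγ => ((f.pos h₁).app i).pos (by rw [h, h₁, one_mul] at hγ; exact hγ),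
      fun hγ => ((f.pos h₁).app i).neg (by rw [h, h₁, one_mul] at hγ; exact hγ)⟩ :=
  dif_pos h₁

lemma coord_neg {γ δ : ℤˣ} {x y : SProd ε V} (f : (⟨x⟩ : Signed δ (SProd ε V)) ⟶ ⟨y⟩) (i : ι)
    (h : γ = δ * ε i) (h₁ : δ = -1) : coord f i h =
    ⟨fun hγ => ((f.neg h₁).app i).neg (by
        rw [h, h₁, neg_one_mul, neg_eq_iff_eq_neg] at hγ; exact hγ),
      fun hγ => ((f.neg h₁).app i).pos (by rw [h, h₁, neg_one_mul, neg_inj] at hγ; exact hγ)⟩ :=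
  dif_neg (by rw [h₁]; decide)

variable {γ δ : ℤˣ} {x y z : SProd ε V}

lemma coord_id (i : ι) (h : γ = δ * ε i) :
    coord (𝟙 (⟨x⟩ : Signed δ (SProd ε V))) i h = 𝟙 _ := by
  unfold coord; split_ifs <;> rfl

lemma coord_comp (f : (⟨x⟩ : Signed δ (SProd ε V)) ⟶ ⟨y⟩)
    (g : (⟨y⟩ : Signed δ (SProd ε V)) ⟶ ⟨z⟩) (i : ι) (h : γ = δ * ε i) :
    coord (f ≫ g) i h = coord f i h ≫ coord g i h := by
  unfold coord; split_ifs <;> rfl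

lemma coord_add [Preadditive V] (f g : (⟨x⟩ : Signed δ (SProd ε V)) ⟶ ⟨y⟩) (i : ι)
    (h : γ = δ * ε i) : coord (f + g) i h = coord f i h + coord g i h := by
  unfold coord; split_ifs <;> rfl

lemma coord_smul {R : Type*} [Semiring R] [Preadditive V] [Linear R V] (r : R)
    (f : (⟨x⟩ : Signed δ (SProd ε V)) ⟶ ⟨y⟩) (i : ι)
    (h : γ = δ * ε i) : coord (r • f) i h = r • coord f i h := by
  unfold coord; split_ifs <;> rfl

lemma coord_iso (e : ∀ i, x.of i ≅ y.of i) (i : ι) (h : γ = δ * ε i) :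
    coord (Signed.iso δ (SProd.iso fun i => Signed.iso (ε i) (e i))).hom i h =
      (Signed.iso γ (e i)).hom := by
  unfold coord; split_ifs <;> rfl

lemma coord_smulIso {k : Type*} [CommRing k] [Preadditive V] [Linear k V] (c : ι → kˣ)
    (e : ∀ i, x.of i ≅ y.of i) (i : ι) (h : γ = δ * ε i) :
    coord (Signed.iso δ (SProd.iso fun i => smulIso (c i) (Signed.iso (ε i) (e i)))).hom i h =
      ((c i ^ (δ : ℤ) : kˣ) : k) • (Signed.iso γ (e i)).hom := by
  rcases Int.units_eq_one_or δ with hδ | hδ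
  · rw [coord_pos _ _ _ hδ]; simp only [hδ, Units.val_one, zpow_one]; rfl
  · rw [coord_neg _ _ _ hδ]; simp only [hδ, Units.val_neg, Units.val_one, zpow_neg, zpow_one]; rfl

lemma coord_ofOne (hδ : δ = 1) (f : x ⟶ y) (i : ι) (h : γ = δ * ε i) :
    coord (Signed.ofOne hδ f) i h = ⟨fun hγ => (f.app i).pos (by rw [← hγ, h, hδ, one_mul]),
      fun hγ => (f.app i).neg (by rw [← hγ, h, hδ, one_mul])⟩ := by
  rw [coord_pos _ _ _ hδ]; rfl

end SProd

section Psi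

lemma iso_trans_hom {V : Type*} [Category* V] (ε : ℤˣ) {x y z : V} (e : x ≅ y) (e' : y ≅ z) :
    (Signed.iso ε e).hom ≫ (Signed.iso ε e').hom = (Signed.iso ε (e ≪≫ e')).hom := rfl

variable {G : Type*} [Group G] {π : G →* ℤˣ} {k : Type*} [CommRing k] {α : TwistedCocycle π k}
  {V : Type*} [Category* V] [Preadditive V] [Linear k V] (ρ : TwistedRep α V)

lemma TwistedRep.ψ_push {γ δ ε : ℤˣ} (a b : G) (h₁ : δ = ε * π a) (h₂ : γ = δ * π b)
    (h₃ : γ = ε * π (a * b)) {x y : V} (u : (⟨x⟩ : Signed γ V) ⟶ ⟨y⟩) :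
    Signed.push (ρ.F a) h₁ (Signed.push (ρ.F b) h₂ u) ≫ (Signed.iso ε (ρ.ψ a b y)).hom =
      (Signed.iso ε (ρ.ψ a b x)).hom ≫ Signed.push (ρ.F (a * b)) h₃ u := by
  ext h
  · exact ρ.ψ_nat a b (x := x) (y := y)
      ⟨fun h' => u.pos (Signed.mul_pp h₃ h h'), fun h' => u.neg (Signed.mul_pn h₃ h h')⟩
  · have := ρ.ψ_nat a b (x := y) (y := x)
      ⟨fun h' => u.neg (Signed.mul_np h₃ h h'), fun h' => u.pos (Signed.mul_nn h₃ h h')⟩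
    exact (Iso.inv_comp_eq _).mpr (((Iso.eq_comp_inv _).mpr this).trans (Category.assoc _ _ _))

lemma TwistedRep.ψe_push {γ ε : ℤˣ} (h₁ : γ = ε * π 1) {x y : V}
    (u : (⟨x⟩ : Signed γ V) ⟶ ⟨y⟩) :
    Signed.push (ρ.F 1) h₁ u ≫ (Signed.iso ε (ρ.ψe y)).hom =
      (Signed.iso ε (ρ.ψe x)).hom ≫
        ⟨fun h => u.pos (by rw [h₁, h, π.map_one, mul_one]),
          fun h => u.neg (by rw [h₁, h, π.map_one, mul_one])⟩ := by
  have hn : ∀ h : π 1 = -1, False := fun h => absurd (π.map_one.symm.trans h) (by decide)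
  ext h
  · refine Eq.trans ?_ (ρ.ψe_nat (u.pos (by rw [h₁, h, π.map_one, mul_one])))
    refine congrArg (· ≫ _) (congrArg (ρ.F 1).map ?_)
    ext h' <;> [rfl; exact (hn h').elim]
  · have h2 : γ = -1 := by rw [h₁, h, π.map_one, mul_one]
    have := ρ.ψe_nat (u.neg h2)
    refine Eq.trans ?_ ((Iso.inv_comp_eq _).mpr
      (((Iso.eq_comp_inv _).mpr this).trans (Category.assoc _ _ _)))
    refine congrArg (_ ≫ ·) (congrArg (ρ.F 1).map ?_)
    ext h' <;> [rfl; exact (hn h').elim]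

lemma TwistedRep.cast_push {ι : Type*} {ε : ι → ℤˣ} {γ₀ δ γ γ' : ℤˣ} {x y : SProd ε V}
    (f : (⟨x⟩ : Signed γ₀ (SProd ε V)) ⟶ ⟨y⟩) {a b : G} (h : a = b) {i j : ι} (hij : i = j)
    (h₁ : γ = γ₀ * ε i) (h₂ : γ' = γ₀ * ε j) (h₃ : γ = δ * π a) (h₄ : γ' = δ * π b) :
    Signed.push (ρ.F a) h₃ (SProd.coord f i h₁) ≫
        (Signed.iso δ (castIso ρ.F h (congrArg y.of hij))).hom =
      (Signed.iso δ (castIso ρ.F h (congrArg x.of hij))).hom ≫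
        Signed.push (ρ.F b) h₄ (SProd.coord f j h₂) := by
  subst h hij
  obtain rfl : γ = γ' := h₃.trans h₄.symm
  have : ∀ z : V, (Signed.iso δ (castIso ρ.F (rfl : a = a) (rfl : z = z))).hom = 𝟙 _ :=
    fun z => rfl
  rw [this, this, Category.comp_id, Category.id_comp]

lemma TwistedRep.assoc_cast {a b c ab c' abc bc abc' : G} {x x' x₁ x₂ x₃ : V}
    (h1 : a * b = ab) (h2 : c = c') (h3 : x = x') (h3' : (ρ.F c).obj ⟨x⟩ = (ρ.F c').obj ⟨x'⟩)
    (h4 : ab * c' = abc) (h5 : x' = x₁)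
    (h6 : abc = abc') (h7 : x₁ = x₂) (h8 : b * c = bc) (h9 : a * bc = abc') (h10 : x = x₃)
    (h11 : x₃ = x₂) :
    smulIso (α.val a b c) (ρ.ψ a b ((ρ.F c).obj ⟨x⟩) ≪≫ castIso ρ.F h1 h3' ≪≫ ρ.ψ ab c' x' ≪≫
        castIso ρ.F h4 h5 ≪≫ castIso ρ.F h6 h7) =
      (ρ.F a).mapIso (Signed.iso (π a) (ρ.ψ b c x ≪≫ castIso ρ.F h8 h10)) ≪≫ ρ.ψ a bc x₃ ≪≫
        castIso ρ.F h9 h11 := by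
  subst h1 h2 h3 h4 h5 h7 h8 h9 h10
  have := ρ.assoc a b c x
  ext
  have h := congrArg Iso.hom this
  simpa [castIso] using h

lemma TwistedRep.unit_left_cast {a b b' c : G} {x x' x₁ x₂ : V} (h1 : a = 1) (h2 : a * b = c)
    (h3 : x = x₁) (h4 : c = b') (h5 : x₁ = x₂) (h6 : b = b') (h7 : x = x₂)
    (hx : (ρ.F b).obj ⟨x⟩ = x') (hx' : x' = (ρ.F b').obj ⟨x₂⟩) :
    ρ.ψ a b x ≪≫ castIso ρ.F h2 h3 ≪≫ castIso ρ.F h4 h5 =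
      castIso ρ.F h1 (hx.trans hx') ≪≫ ρ.ψe ((ρ.F b').obj ⟨x₂⟩) := by
  subst h1 h2 h3 h5 h6
  have h := congrArg Iso.hom (ρ.unit_left b x)
  ext
  simpa [castIso] using h

lemma TwistedRep.unit_right_cast {a b c a' : G} {x x₁ x₂ : V} (h1 : b = 1) (h2 : a * b = c)
    (h3 : x = x₁) (h4 : c = a') (h5 : x₁ = x₂) (h6 : a = a') (h7 : x = x₂) :
    ρ.ψ a b x ≪≫ castIso ρ.F h2 h3 ≪≫ castIso ρ.F h4 h5 =
      (ρ.F a).mapIso (Signed.iso (π a) (castIso ρ.F h1 h7 ≪≫ ρ.ψe x₂)) ≪≫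
        castIso ρ.F h6 rfl := by
  subst h1 h2 h3 h5 h6
  have h := congrArg Iso.hom (ρ.unit_right a x)
  ext
  simpa [castIso] using h

end Psi

section Induction

variable {G : Type*} [Group G] {π : G →* ℤˣ} {H : Subgroup G} {k : Type*} [CommRing k]
  {α : TwistedCocycle π k} {V : Type*} [Category* V] [Preadditive V] [Linear k V]

/-- A choice of representatives `σ_j` of the cosets `σ H`. -/
structure CosetReps (H : Subgroup G) where
  /-- the representative of the coset -/
  s : G ⧸ H → G
  mk_s : ∀ j, (s j : G ⧸ H) = j

namespace CosetReps

variable (S : CosetReps H)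

/-- The element `η` of `H` with `ω σ_i = σ_j η`, where `i = ω⁻¹ j` is the coset of `ω⁻¹ σ_j`. -/
def eta (ω : G) (j : G ⧸ H) : H :=
  ⟨(S.s j)⁻¹ * (ω * S.s (ω⁻¹ • j)), by
    rw [← QuotientGroup.eq, S.mk_s, ← smul_eq_mul, ← MulAction.Quotient.smul_coe, S.mk_s,
      smul_inv_smul]⟩

lemma s_mul_eta (ω : G) (j : G ⧸ H) : S.s j * S.eta ω j = ω * S.s (ω⁻¹ • j) := by
  simp [eta]

lemma idx_mul (ω₂ ω₁ : G) (j : G ⧸ H) : ω₁⁻¹ • ω₂⁻¹ • j = (ω₂ * ω₁)⁻¹ • j := by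
  rw [mul_inv_rev, mul_smul]

lemma idx_one (j : G ⧸ H) : (1 : G)⁻¹ • j = j := by rw [inv_one, one_smul]

lemma eta_mul (ω₂ ω₁ : G) (j : G ⧸ H) :
    S.eta ω₂ j * S.eta ω₁ (ω₂⁻¹ • j) = S.eta (ω₂ * ω₁) j := by
  apply Subtype.ext
  apply mul_left_cancel (a := S.s j)
  rw [s_mul_eta, Subgroup.coe_mul, ← mul_assoc, s_mul_eta, mul_assoc, s_mul_eta, idx_mul, mul_assoc]

lemma eta_one (j : G ⧸ H) : S.eta 1 j = 1 := by
  apply Subtype.ext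
  apply mul_left_cancel (a := S.s j)
  rw [s_mul_eta, idx_one, one_mul, Subgroup.coe_one, mul_one]

lemma sign (π : G →* ℤˣ) (ω : G) (j : G ⧸ H) :
    π ω * π (S.s (ω⁻¹ • j)) = π (S.s j) * resGrading π H (S.eta ω j) := by
  rw [← map_mul, ← s_mul_eta, map_mul]; rfl

/-- The scalar `α([ω₂|σ_j|η₁]) / (α([ω₂|ω₁|σ_i]) α([σ_k|η₂|η₁]))`, where `ω₁ σ_i = σ_j η₁` and
`ω₂ σ_j = σ_k η₂`. -/
def coeff (α : TwistedCocycle π k) (ω₂ ω₁ : G) (l : G ⧸ H) : kˣ :=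
  α.val ω₂ (S.s (ω₂⁻¹ • l)) (S.eta ω₁ (ω₂⁻¹ • l)) /
    (α.val ω₂ ω₁ (S.s (ω₁⁻¹ • ω₂⁻¹ • l)) *
      α.val (S.s l) (S.eta ω₂ l) (S.eta ω₁ (ω₂⁻¹ • l)))

end CosetReps


namespace RInd

variable (ρ : TwistedRep (α.res H) V) (S : CosetReps H)

/-- The category `∏ i, ^π(σ_i) V`. -/
abbrev Cat (π : G →* ℤˣ) (S : CosetReps H) (V : Type*) := SProd (fun i => π (S.s i)) V

/-- The functor `RInd(ω)`, given by the matrix whose `(j, i)` entry is `^π(σ_j) ρ(η)` if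
`ω σ_i = σ_j η` with `η` in `H`, and zero if there is no such `η`. For given `j`, the only nonzero
entry is the one with `i = ω⁻¹ j`. -/
def F (ω : G) : Signed (π ω) (Cat π S V) ⥤ Cat π S V where
  obj x := ⟨fun j => (ρ.F (S.eta ω j)).obj ⟨x.of.of (ω⁻¹ • j)⟩⟩
  map f := ⟨fun j => Signed.push (ρ.F (S.eta ω j)) (S.sign π ω j)
    (SProd.coord f (ω⁻¹ • j) rfl)⟩
  map_id x := SProd.hom_ext fun j => by
    exact (congrArg _ (SProd.coord_id (x := x.of) _ _)).trans (Signed.push_id _ (S.sign π ω j) _)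
  map_comp f g := SProd.hom_ext fun j => by
    exact (congrArg _ (SProd.coord_comp f g _ _)).trans (Signed.push_comp _ (S.sign π ω j) _ _)

/-- The components of the `2`-isomorphisms `RInd(ψ)_{ω₂, ω₁}`, given at the entry `(k, i)` by
`^π(σ_k) ψ_{η₂, η₁} ^ π(σ_k)`, multiplied by a scalar, where `ω₁ σ_i = σ_j η₁` and
`ω₂ σ_j = σ_k η₂`. -/
def psi (ω₂ ω₁ : G) (x : Cat π S V) :
    (F ρ S ω₂).obj ⟨(F ρ S ω₁).obj ⟨x⟩⟩ ≅ (F ρ S (ω₂ * ω₁)).obj ⟨x⟩ :=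
  SProd.iso fun l => smulIso (S.coeff α ω₂ ω₁ l) (Signed.iso (π (S.s l))
    (ρ.ψ (S.eta ω₂ l) (S.eta ω₁ (ω₂⁻¹ • l)) (x.of (ω₁⁻¹ • ω₂⁻¹ • l)) ≪≫
      castIso ρ.F (S.eta_mul ω₂ ω₁ l) (congrArg x.of (CosetReps.idx_mul ω₂ ω₁ l))))

/-- The components of the `2`-isomorphism `RInd(ψ)_e`, given by `^π(σ_i) ψ_e ^ π(σ_i)`. -/
def psiE (x : Cat π S V) : (F ρ S 1).obj ⟨x⟩ ≅ x :=
  SProd.iso fun j => Signed.iso (π (S.s j))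
    (castIso ρ.F (S.eta_one j) (congrArg x.of (CosetReps.idx_one j)) ≪≫ ρ.ψe (x.of j))

instance (ω : G) : (F ρ S ω).Additive where
  map_add {_ _ f g} := SProd.hom_ext fun j =>
    (congrArg _ (SProd.coord_add f g _ _)).trans (Signed.push_add _ (S.sign π ω j) _ _)

instance (ω : G) : (F ρ S ω).Linear k where
  map_smul f r := SProd.hom_ext fun j =>
    (congrArg _ (SProd.coord_smul r f _ _)).trans (Signed.push_smul _ (S.sign π ω j) _ _)

lemma F_map_app (ω : G) {x y : Cat π S V} (f : (⟨x⟩ : Signed (π ω) (Cat π S V)) ⟶ ⟨y⟩)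
    (j : G ⧸ H) : ((F ρ S ω).map f).app j = Signed.push (ρ.F (S.eta ω j)) (S.sign π ω j)
      (SProd.coord f (ω⁻¹ • j) rfl) := rfl

lemma coord_push {γ δ γ' γ'' : ℤˣ} (ω : G) {x y : Cat π S V} (h : γ = δ * π ω)
    (f : (⟨x⟩ : Signed γ (Cat π S V)) ⟶ ⟨y⟩) (j : G ⧸ H) (h' : γ' = δ * π (S.s j))
    (h'' : γ'' = γ * π (S.s (ω⁻¹ • j))) (h₃ : γ'' = γ' * resGrading π H (S.eta ω j)) :
    SProd.coord (Signed.push (F ρ S ω) h f) j h' =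
      Signed.push (ρ.F (S.eta ω j)) h₃ (SProd.coord f (ω⁻¹ • j) h'') := by
  rcases Int.units_eq_one_or δ with hδ | hδ
  · rw [SProd.coord_pos _ _ _ hδ]
    ext hγ
    · refine congrArg (ρ.F (S.eta ω j)).map ?_
      rcases Int.units_eq_one_or (π ω) with hω | hω
      · rw [SProd.coord_pos _ _ _ hω, SProd.coord_pos f _ _ (by rw [h, hδ, hω]; rfl)]
      · rw [SProd.coord_neg _ _ _ hω, SProd.coord_neg f _ _ (by rw [h, hδ, hω]; rfl)]
    · refine congrArg (ρ.F (S.eta ω j)).map ?_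
      rcases Int.units_eq_one_or (π ω) with hω | hω
      · rw [SProd.coord_pos _ _ _ hω, SProd.coord_pos f _ _ (by rw [h, hδ, hω]; rfl)]
      · rw [SProd.coord_neg _ _ _ hω, SProd.coord_neg f _ _ (by rw [h, hδ, hω]; rfl)]
  · rw [SProd.coord_neg _ _ _ hδ]
    ext hγ
    · refine congrArg (ρ.F (S.eta ω j)).map ?_
      rcases Int.units_eq_one_or (π ω) with hω | hω
      · rw [SProd.coord_pos _ _ _ hω, SProd.coord_neg f _ _ (by rw [h, hδ, hω]; rfl)]
      · rw [SProd.coord_neg _ _ _ hω, SProd.coord_pos f _ _ (by rw [h, hδ, hω]; rfl)]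
    · refine congrArg (ρ.F (S.eta ω j)).map ?_
      rcases Int.units_eq_one_or (π ω) with hω | hω
      · rw [SProd.coord_pos _ _ _ hω, SProd.coord_neg f _ _ (by rw [h, hδ, hω]; rfl)]
      · rw [SProd.coord_neg _ _ _ hω, SProd.coord_pos f _ _ (by rw [h, hδ, hω]; rfl)]

lemma psi_nat (ω₂ ω₁ : G) {x y : Cat π S V}
    (f : (⟨x⟩ : Signed (π (ω₂ * ω₁)) (Cat π S V)) ⟶ ⟨y⟩) :
    (F ρ S ω₂).map (Signed.push (F ρ S ω₁) (π.map_mul ω₂ ω₁) f) ≫ (psi ρ S ω₂ ω₁ y).hom =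
      (psi ρ S ω₂ ω₁ x).hom ≫ (F ρ S (ω₂ * ω₁)).map f := by
  refine SProd.hom_ext fun l => ?_
  have e : π (ω₂ * ω₁) * π (S.s (ω₁⁻¹ • ω₂⁻¹ • l)) =
      π ω₂ * π (S.s (ω₂⁻¹ • l)) * resGrading π H (S.eta ω₁ (ω₂⁻¹ • l)) := by
    rw [map_mul, mul_assoc, S.sign π ω₁, mul_assoc]
  have e' : π (ω₂ * ω₁) * π (S.s (ω₁⁻¹ • ω₂⁻¹ • l)) =
      π (S.s l) * resGrading π H (S.eta ω₂ l * S.eta ω₁ (ω₂⁻¹ • l)) := by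
    rw [e, S.sign π ω₂, map_mul, mul_assoc]
  have h0 := coord_push ρ S ω₁ (π.map_mul ω₂ ω₁) f (ω₂⁻¹ • l) rfl rfl e
  have h1 := ρ.ψ_push (S.eta ω₂ l) (S.eta ω₁ (ω₂⁻¹ • l)) (S.sign π ω₂ l) e e'
    (SProd.coord f (ω₁⁻¹ • ω₂⁻¹ • l) rfl)
  have h2 := ρ.cast_push f (S.eta_mul ω₂ ω₁ l) (CosetReps.idx_mul ω₂ ω₁ l) rfl rfl e'
    (S.sign π (ω₂ * ω₁) l)
  have key := h1 =≫ (Signed.iso (π (S.s l)) (castIso ρ.F (S.eta_mul ω₂ ω₁ l)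
    (congrArg y.of (CosetReps.idx_mul ω₂ ω₁ l)))).hom
  rw [Category.assoc, Category.assoc, h2, ← Category.assoc (Signed.iso _ _).hom,
    iso_trans_hom, iso_trans_hom] at key
  refine (congrArg (· ≫ _) (congrArg (Signed.push _ (S.sign π ω₂ l)) h0)).trans ?_
  exact (Linear.comp_smul _ _ _ _ _ _).trans
    ((congrArg (((S.coeff α ω₂ ω₁ l : kˣ) : k) • ·) key).trans
      (Linear.smul_comp _ _ _ _ _ _).symm)

lemma psiE_nat {x y : Cat π S V} (f : x ⟶ y) :
    (F ρ S 1).map (Signed.ofOne π.map_one f) ≫ (psiE ρ S y).hom = (psiE ρ S x).hom ≫ f := by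
  refine SProd.hom_ext fun j => ?_
  have e : π 1 * π (S.s j) = π (S.s j) * resGrading π H 1 := by simp
  have h2 := ρ.cast_push (Signed.ofOne π.map_one f) (S.eta_one j) (CosetReps.idx_one j) rfl rfl
    (S.sign π 1 j) e
  have h3 := ρ.ψe_push e (SProd.coord (Signed.ofOne π.map_one f) j rfl)
  have key := h2 =≫ (Signed.iso (π (S.s j)) (ρ.ψe (y.of j))).hom
  rw [Category.assoc, Category.assoc, h3, ← Category.assoc (Signed.iso _ _).hom,
    iso_trans_hom, iso_trans_hom] at key
  refine key.trans (congrArg (_ ≫ ·) ?_)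
  rw [SProd.coord_ofOne]
  rfl

lemma castIso_app {a b : G} (h : a = b) (x : Cat π S V) (j : G ⧸ H) :
    (castIso (F ρ S) h (rfl : x = x)).hom.app j =
      (Signed.iso (π (S.s j)) (castIso ρ.F (congrArg (S.eta · j) h)
        (congrArg (fun c : G => x.of (c⁻¹ • j)) h))).hom := by
  subst h; rfl

lemma coeff_assoc (α : TwistedCocycle π k) (ω₃ ω₂ ω₁ : G) (l : G ⧸ H) :
    α.val ω₃ ω₂ ω₁ * (S.coeff α ω₃ ω₂ l * S.coeff α (ω₃ * ω₂) ω₁ l) =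
      S.coeff α ω₂ ω₁ (ω₃⁻¹ • l) ^ (π ω₃ : ℤ) * S.coeff α ω₃ (ω₂ * ω₁) l *
        α.val (S.eta ω₃ l) (S.eta ω₂ (ω₃⁻¹ • l)) (S.eta ω₁ (ω₂⁻¹ • ω₃⁻¹ • l)) ^
          (π (S.s l) : ℤ) := by
  have e3 := S.s_mul_eta ω₃ l
  have e2 := S.s_mul_eta ω₂ (ω₃⁻¹ • l)
  have e1 := S.s_mul_eta ω₁ (ω₂⁻¹ • ω₃⁻¹ • l)
  have e32 := congrArg Subtype.val (S.eta_mul ω₃ ω₂ l)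
  have e21 := congrArg Subtype.val (S.eta_mul ω₂ ω₁ (ω₃⁻¹ • l))
  rw [Subgroup.coe_mul] at e32 e21
  simp only [CosetReps.coeff, ← CosetReps.idx_mul, ← e32, ← e21]
  generalize (S.eta ω₃ l : G) = η₃ at *
  generalize (S.eta ω₂ (ω₃⁻¹ • l) : G) = η₂ at *
  generalize (S.eta ω₁ (ω₂⁻¹ • ω₃⁻¹ • l) : G) = η₁ at *
  generalize S.s (ω₁⁻¹ • ω₂⁻¹ • ω₃⁻¹ • l) = I at *
  generalize S.s (ω₂⁻¹ • ω₃⁻¹ • l) = J at *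
  generalize S.s (ω₃⁻¹ • l) = K at *
  generalize S.s l = L at *
  have c1 := α.cocycle ω₃ ω₂ ω₁ I
  have c2 := α.cocycle ω₃ ω₂ J η₁
  have c3 := α.cocycle ω₃ K η₂ η₁
  have c4 := α.cocycle L η₃ η₂ η₁
  rw [← e1] at c1
  rw [← e2] at c2
  rw [← e3] at c3
  rw [div_zpow, mul_zpow]
  apply Additive.ofMul.injective
  apply_fun Additive.ofMul at c1 c2 c3 c4
  simp only [ofMul_mul, ofMul_div, ofMul_zpow] at c1 c2 c3 c4 ⊢
  rw [← sub_eq_zero] at c1 c2 c3 c4 ⊢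
  refine Eq.trans ?_ (congrArg₂ (· - ·) (congrArg₂ (· + ·) c1 c3) (congrArg₂ (· + ·) c2 c4)
    |>.trans (by simp))
  abel

lemma psi_assoc (ω₃ ω₂ ω₁ : G) (x : Cat π S V) :
    smulIso (α.val ω₃ ω₂ ω₁) (psi ρ S ω₃ ω₂ ((F ρ S ω₁).obj ⟨x⟩) ≪≫ psi ρ S (ω₃ * ω₂) ω₁ x) ≪≫
        castIso (F ρ S) (mul_assoc ω₃ ω₂ ω₁) rfl =
      (F ρ S ω₃).mapIso (Signed.iso (π ω₃) (psi ρ S ω₂ ω₁ x)) ≪≫ psi ρ S ω₃ (ω₂ * ω₁) x := by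
  apply Iso.ext
  refine SProd.hom_ext fun l => ?_
  have core := ρ.assoc_cast (S.eta_mul ω₃ ω₂ l)
    (congrArg (S.eta ω₁) (CosetReps.idx_mul ω₃ ω₂ l))
    (congrArg (fun i => x.of (ω₁⁻¹ • i)) (CosetReps.idx_mul ω₃ ω₂ l))
    (congrArg ((F ρ S ω₁).obj ⟨x⟩).of (CosetReps.idx_mul ω₃ ω₂ l))
    (S.eta_mul (ω₃ * ω₂) ω₁ l) (congrArg x.of (CosetReps.idx_mul (ω₃ * ω₂) ω₁ l))
    (congrArg (S.eta · l) (mul_assoc ω₃ ω₂ ω₁))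
    (congrArg (fun c : G => x.of (c⁻¹ • l)) (mul_assoc ω₃ ω₂ ω₁))
    (S.eta_mul ω₂ ω₁ (ω₃⁻¹ • l)) (S.eta_mul ω₃ (ω₂ * ω₁) l)
    (congrArg x.of (CosetReps.idx_mul ω₂ ω₁ (ω₃⁻¹ • l)))
    (congrArg x.of (CosetReps.idx_mul ω₃ (ω₂ * ω₁) l))
  have hco := SProd.coord_smulIso (δ := π ω₃) (ε := fun i => π (S.s i))
    (S.coeff α ω₂ ω₁) (fun l =>
    (ρ.ψ (S.eta ω₂ l) (S.eta ω₁ (ω₂⁻¹ • l)) (x.of (ω₁⁻¹ • ω₂⁻¹ • l)) ≪≫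
      castIso ρ.F (S.eta_mul ω₂ ω₁ l) (congrArg x.of (CosetReps.idx_mul ω₂ ω₁ l))))
    (x := (F ρ S ω₂).obj ⟨(F ρ S ω₁).obj ⟨x⟩⟩) (y := (F ρ S (ω₂ * ω₁)).obj ⟨x⟩)
    (ω₃⁻¹ • l) rfl
  have hR : ((F ρ S ω₃).map (Signed.iso (π ω₃) (psi ρ S ω₂ ω₁ x)).hom).app l =
      ((S.coeff α ω₂ ω₁ (ω₃⁻¹ • l) ^ (π ω₃ : ℤ) : kˣ) : k) • (Signed.iso (π (S.s l))
        ((ρ.F (S.eta ω₃ l)).mapIso (Signed.iso (resGrading π H (S.eta ω₃ l)) _))).hom :=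
    ((congrArg (Signed.push _ (S.sign π ω₃ l)) hco).trans
      (Signed.push_smul _ (S.sign π ω₃ l) _ _)).trans
      (congrArg (_ • ·) (Signed.push_iso _ (S.sign π ω₃ l) _))
  have hc := castIso_app ρ S (mul_assoc ω₃ ω₂ ω₁) x l
  have core' := congrArg (fun e => (Signed.iso (π (S.s l)) e).hom) core
  simp only [iso_smulIso, smulIso_hom, ← iso_trans_hom, TwistedCocycle.res_val] at core'
  refine Eq.trans (congrArg (_ ≫ ·) hc) (Eq.trans ?_ (congrArg (· ≫ _) hR).symm)
  have sc := congrArg Units.val (coeff_assoc S α ω₃ ω₂ ω₁ l)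
  have aux : ∀ {a b c d e f g : Signed (π (S.s l)) V} (p₁ : a ⟶ b) (p₂ : b ⟶ c) (p₃ : c ⟶ d)
      (p₄ : d ⟶ e) (p₅ : e ⟶ f) (q₁ : a ⟶ g) (q₂ : g ⟶ f) (r₀ r₁ r₂ t₁ t₂ w : k),
      r₀ * (r₁ * r₂) = t₁ * t₂ * w → w • (p₁ ≫ p₂ ≫ p₃ ≫ p₄ ≫ p₅) = q₁ ≫ q₂ →
      (r₀ • ((r₁ • (p₁ ≫ p₂)) ≫ (r₂ • (p₃ ≫ p₄)))) ≫ p₅ = (t₁ • q₁) ≫ (t₂ • q₂) := by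
    intro a b c d e f g p₁ p₂ p₃ p₄ p₅ q₁ q₂ r₀ r₁ r₂ t₁ t₂ w h h'
    simp only [Linear.smul_comp, Linear.comp_smul, smul_smul, Category.assoc, ← h']
    congr 1
    linear_combination h
  rw [Units.val_mul, Units.val_mul, Units.val_mul, Units.val_mul] at sc
  exact aux _ _ _ _ _ _ _ _ _ _ _ _ _ sc core'

lemma psi_unit_left (ω : G) (x : Cat π S V) :
    psi ρ S 1 ω x ≪≫ castIso (F ρ S) (one_mul ω) rfl = psiE ρ S ((F ρ S ω).obj ⟨x⟩) := by
  apply Iso.ext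
  refine SProd.hom_ext fun l => ?_
  have core := ρ.unit_left_cast (S.eta_one l) (S.eta_mul 1 ω l)
    (congrArg x.of (CosetReps.idx_mul 1 ω l)) (congrArg (S.eta · l) (one_mul ω))
    (congrArg (fun c : G => x.of (c⁻¹ • l)) (one_mul ω))
    (congrArg (S.eta ω) (CosetReps.idx_one l))
    (congrArg (fun i => x.of (ω⁻¹ • i)) (CosetReps.idx_one l)) rfl
    (congrArg ((F ρ S ω).obj ⟨x⟩).of (CosetReps.idx_one l))
  have hc := castIso_app ρ S (one_mul ω) x l
  have core' := congrArg (fun e => (Signed.iso (π (S.s l)) e).hom) core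
  have sc : S.coeff α 1 ω l = 1 := by
    simp [CosetReps.coeff, CosetReps.eta_one, α.one_left, α.one_mid]
  refine Eq.trans (congrArg (_ ≫ ·) hc) (Eq.trans ?_ core')
  change (((S.coeff α 1 ω l : kˣ) : k) • _) ≫ _ = _
  rw [sc, Units.val_one, one_smul]
  exact (iso_trans_hom _ _ _).trans
    (congrArg (fun e => (Signed.iso (π (S.s l)) e).hom) (Iso.trans_assoc _ _ _))

lemma psi_unit_right (ω : G) (x : Cat π S V) :
    psi ρ S ω 1 x ≪≫ castIso (F ρ S) (mul_one ω) rfl =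
      (F ρ S ω).mapIso (Signed.iso (π ω) (psiE ρ S x)) := by
  apply Iso.ext
  refine SProd.hom_ext fun l => ?_
  have core := ρ.unit_right_cast (a' := S.eta ω l) (S.eta_one (ω⁻¹ • l)) (S.eta_mul ω 1 l)
    (congrArg x.of (CosetReps.idx_mul ω 1 l)) (congrArg (S.eta · l) (mul_one ω))
    (congrArg (fun c : G => x.of (c⁻¹ • l)) (mul_one ω)) rfl
    (congrArg x.of (CosetReps.idx_one (ω⁻¹ • l)))
  have hc := castIso_app ρ S (mul_one ω) x l
  have core' := congrArg (fun e => (Signed.iso (π (S.s l)) e).hom) core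
  have sc : S.coeff α ω 1 l = 1 := by
    simp [CosetReps.coeff, CosetReps.eta_one, α.one_right, α.one_mid]
  have hco := SProd.coord_iso (δ := π ω) (ε := fun i => π (S.s i))
    (x := (F ρ S 1).obj ⟨x⟩) (y := x)
    (fun j => castIso ρ.F (S.eta_one j) (congrArg x.of (CosetReps.idx_one j)) ≪≫ ρ.ψe (x.of j))
    (ω⁻¹ • l) rfl
  have hR : ((F ρ S ω).map (Signed.iso (π ω) (psiE ρ S x)).hom).app l =
      (Signed.iso (π (S.s l))
        ((ρ.F (S.eta ω l)).mapIso (Signed.iso (resGrading π H (S.eta ω l)) _))).hom :=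
    (congrArg (Signed.push _ (S.sign π ω l)) hco).trans (Signed.push_iso _ (S.sign π ω l) _)
  refine Eq.trans (congrArg (_ ≫ ·) hc) (Eq.trans ?_ hR.symm)
  have hcast : ∀ (e : H) (z : V), castIso ρ.F (rfl : e = e) (rfl : z = z) = Iso.refl _ :=
    fun _ _ => rfl
  rw [hcast, Iso.trans_refl] at core'
  refine Eq.trans ?_ core'
  change (((S.coeff α ω 1 l : kˣ) : k) • _) ≫ _ = _
  rw [sc, Units.val_one, one_smul]
  exact (iso_trans_hom _ _ _).trans
    (congrArg (fun e => (Signed.iso (π (S.s l)) e).hom) (Iso.trans_assoc _ _ _))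

end RInd

/-- The Real `2`-induction of `ρ` from `H` to `G`, with respect to a choice of representatives of
the cosets. -/
def RInd (ρ : TwistedRep (α.res H) V) (S : CosetReps H) : TwistedRep α (RInd.Cat π S V) where
  F := RInd.F ρ S
  additive _ := inferInstance
  linear _ := inferInstance
  ψ := RInd.psi ρ S
  ψ_nat ω₂ ω₁ _ _ f := RInd.psi_nat ρ S ω₂ ω₁ f
  ψe := RInd.psiE ρ S
  ψe_nat f := RInd.psiE_nat ρ S f
  assoc := RInd.psi_assoc ρ S
  unit_left := RInd.psi_unit_left ρ S
  unit_right := RInd.psi_unit_right ρ S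

end Induction

noncomputable instance {G : Type*} [Group G] [Fintype G] {π : G →* ℤˣ} (p : GComm π)
    (H : Subgroup G) : Fintype {σ : G // (p.conj σ).Mem H} :=
  Fintype.ofFinite _

end Real2

/-!
The operators `β` compose up to transgression: `β_b ∘ β_a = τ^ref([b|a]) • β_{ba}`. Hence every
`β_σ` is bijective and carries `β_ω` to a scalar multiple of `β_{σωσ⁻¹}`, the scalar being the
double transgression `ττ^ref`.

For the induced representation, the projections of `∏ i, ^π(σ_i) V` to its factors act on the
categorical trace of `g` by orthogonal idempotents, the blocks, indexed by the cosets `i` and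
summing to `1`. The block of `i` vanishes unless `g` fixes `i`, and `β_ω` carries the block of `i`
to that of `ω • i`. So only the cosets fixed by both `g` and `ω` contribute to the trace of `β_ω`.
The block of the trivial coset is the categorical trace of `ρ`, by means of an intertwiner from
the restriction of the induced representation to `ρ`, and conjugating by `β_σ` moves the block of
`σ⁻¹H` to this one. Summing over `σ` in place of the cosets counts every coset `|H|` times.
-/

namespace Real2

namespace Signed

variable {γ δ : ℤˣ} {C : Type*} [Category* C]

/-- A morphism of `^γ C`, read as a morphism of `^δ C` for `γ = δ`. -/
@[simps]
def recast (h : γ = δ) {x y : C} (f : (⟨x⟩ : Signed γ C) ⟶ ⟨y⟩) :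
    (⟨x⟩ : Signed δ C) ⟶ ⟨y⟩ where
  pos h' := f.pos (h.trans h')
  neg h' := f.neg (h.trans h')

/-- A morphism of `^(-δ) C`, read as a morphism of `^δ C` in the opposite direction. -/
@[simps]
def flip (h : γ = -δ) {x y : C} (f : (⟨x⟩ : Signed γ C) ⟶ ⟨y⟩) :
    (⟨y⟩ : Signed δ C) ⟶ ⟨x⟩ where
  pos h' := f.neg (by rw [h, h'])
  neg h' := f.pos (by rw [h, h', neg_neg])

end Signed

namespace TwistedRep

variable {G : Type*} [Group G] {π : G →* ℤˣ} {k : Type*} [CommRing k] {α : TwistedCocycle π k}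
  {V : Type*} [Category* V] [Preadditive V] [Linear k V] (ρ : TwistedRep α V)

/-- The isomorphism `ψ_{a,b}` from `ρ(a) ∘ ^π(a) ρ(b)` to `ρ(c)` for `a b = c`. -/
def mu {a b c : G} (h : a * b = c) (x : V) :
    (ρ.F a).obj ⟨(ρ.F b).obj ⟨x⟩⟩ ≅ (ρ.F c).obj ⟨x⟩ :=
  ρ.ψ a b x ≪≫ castIso ρ.F h rfl

lemma mu_rfl (a b : G) (x : V) : ρ.mu (rfl : a * b = _) x = ρ.ψ a b x :=
  Iso.trans_refl _

section Pentagon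

variable {a b c p q r : G} (hab : a * b = p) (hbc : b * c = q) (hp : p * c = r) (hq : a * q = r)

lemma mu_assoc (x : V) :
    (ρ.F a).map (Signed.iso (π a) (ρ.mu hbc x)).hom ≫ (ρ.mu hq x).hom =
      α.val a b c • ((ρ.mu hab ((ρ.F c).obj ⟨x⟩)).hom ≫ (ρ.mu hp x).hom) := by
  have := congrArg Iso.hom (ρ.assoc_cast (x := x) hab (rfl : c = c) rfl rfl hp rfl rfl rfl hbc hq
    rfl rfl)
  simpa [mu, castIso, Units.smul_def] using this.symm

lemma map_mu_inv_comp_mu (x : V) :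
    (ρ.F a).map (Signed.iso (π a) (ρ.mu hbc x)).inv ≫
        (ρ.mu hab ((ρ.F c).obj ⟨x⟩)).hom ≫ (ρ.mu hp x).hom =
      (α.val a b c)⁻¹ • (ρ.mu hq x).hom := by
  rw [eq_inv_smul_iff, ← Linear.comp_units_smul, ← ρ.mu_assoc hab hbc hp hq x,
    ← Functor.map_comp_assoc, Iso.inv_hom_id,
    CategoryTheory.Functor.map_id, Category.id_comp]

lemma mu_inv_comp_map_mu (x : V) :
    (ρ.mu hab ((ρ.F c).obj ⟨x⟩)).inv ≫ (ρ.F a).map (Signed.iso (π a) (ρ.mu hbc x)).hom =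
      α.val a b c • ((ρ.mu hp x).hom ≫ (ρ.mu hq x).inv) := by
  rw [Iso.inv_comp_eq, Linear.comp_units_smul, ← Category.assoc, ← Linear.units_smul_comp,
    ← ρ.mu_assoc hab hbc hp hq x, Category.assoc, Iso.hom_inv_id, Category.comp_id]

end Pentagon

lemma mu_push {γ δ ε : ℤˣ} {a b c : G} (h : a * b = c) (h₁ : δ = ε * π a) (h₂ : γ = δ * π b)
    (h₃ : γ = ε * π c) {x y : V} (u : (⟨x⟩ : Signed γ V) ⟶ ⟨y⟩) :
    Signed.push (ρ.F a) h₁ (Signed.push (ρ.F b) h₂ u) ≫ (Signed.iso ε (ρ.mu h y)).hom =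
      (Signed.iso ε (ρ.mu h x)).hom ≫ Signed.push (ρ.F c) h₃ u := by
  subst h
  rw [mu_rfl, mu_rfl, ρ.ψ_push a b h₁ h₂ h₃ u]

lemma mu_nat {γ : ℤˣ} {a b c : G} (h : a * b = c) (h₁ : γ = π a * π b) (h₂ : γ = π c) {x y : V}
    (f : (⟨x⟩ : Signed γ V) ⟶ ⟨y⟩) :
    (ρ.F a).map (Signed.push (ρ.F b) h₁ f) ≫ (ρ.mu h y).hom =
      (ρ.mu h x).hom ≫ (ρ.F c).map (Signed.recast h₂ f) := by
  subst h h₂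
  rw [mu_rfl, mu_rfl]
  exact ρ.ψ_nat a b f

lemma mu_one_left (a : G) (x : V) : ρ.mu (one_mul a) x = ρ.ψe ((ρ.F a).obj ⟨x⟩) :=
  ρ.unit_left a x

lemma mu_one_right (a : G) (x : V) :
    (ρ.mu (mul_one a) x).hom = (ρ.F a).map (Signed.iso (π a) (ρ.ψe x)).hom :=
  congrArg Iso.hom (ρ.unit_right a x)

lemma cap_eq {a b : G} (h : a * b = 1) (x : V) : ρ.cap h x = ρ.mu h x ≪≫ ρ.ψe x := by
  ext; simp [cap, mu]

lemma cap_hom_obj {a b c : G} (h : a * b = 1) (x : V) :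
    (ρ.cap h ((ρ.F c).obj ⟨x⟩)).hom = (ρ.mu h _).hom ≫ (ρ.mu (one_mul c) x).hom := by
  rw [cap_eq, mu_one_left, Iso.trans_hom]

lemma map_cap_hom {a b c : G} (h : b * c = 1) (x : V) :
    (ρ.F a).map (Signed.iso (π a) (ρ.cap h x)).hom =
      (ρ.F a).map (Signed.iso (π a) (ρ.mu h x)).hom ≫ (ρ.mu (mul_one a) x).hom := by
  rw [cap_eq, ← iso_trans_hom, Functor.map_comp, mu_one_right]

lemma map_cap_eq_smul_cap {a b : G} (hab : a * b = 1) (hba : b * a = 1) (x : V) :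
    (ρ.F a).map (Signed.iso (π a) (ρ.cap hba x)).hom =
      α.val a b a • (ρ.cap hab ((ρ.F a).obj ⟨x⟩)).hom := by
  rw [map_cap_hom, cap_hom_obj, ρ.mu_assoc hab hba (one_mul a) (mul_one a) x]

lemma cap_push {γ δ ε : ℤˣ} {a b : G} (h : a * b = 1) (h₁ : δ = ε * π a) (h₂ : γ = δ * π b)
    (h₃ : γ = ε) {x y : V} (u : (⟨x⟩ : Signed γ V) ⟶ ⟨y⟩) :
    Signed.push (ρ.F a) h₁ (Signed.push (ρ.F b) h₂ u) ≫ (Signed.iso ε (ρ.cap h y)).hom =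
      (Signed.iso ε (ρ.cap h x)).hom ≫ Signed.recast h₃ u := by
  have h₁' : γ = ε * π 1 := by rw [map_one, mul_one, h₃]
  rw [cap_eq, cap_eq, ← iso_trans_hom, ← iso_trans_hom, ← Category.assoc,
    ρ.mu_push h h₁ h₂ h₁' u, Category.assoc, ρ.ψe_push h₁' u, Category.assoc]
  rfl

lemma push_eq_ofOne {a : G} (h : π a = 1 * π a) {x y : V} (f : (⟨x⟩ : Signed (π a) V) ⟶ ⟨y⟩) :
    Signed.push (ρ.F a) h f = Signed.ofOne rfl ((ρ.F a).map f) := by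
  ext h' <;> [rfl; exact absurd h' (by decide)]

/-- The equivalence `ρ(a) : ^π(a) V ≌ V`, with the quasi-inverse induced by `ρ(a⁻¹)`. -/
noncomputable def equiv (a : G) : Signed (π a) V ≌ V :=
  have hs : (1 : ℤˣ) = π a * π a⁻¹ := by rw [← map_mul, mul_inv_cancel, map_one]
  CategoryTheory.Equivalence.mk (ρ.F a)
    { obj := fun x => ⟨(ρ.F a⁻¹).obj ⟨x⟩⟩
      map := fun f => Signed.push (ρ.F a⁻¹) hs (Signed.ofOne rfl f)
      map_id := fun x => by rw [Signed.ofOne_id, Signed.push_id]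
      map_comp := fun f g => by rw [Signed.ofOne_comp, Signed.push_comp] }
    (NatIso.ofComponents (fun x => (Signed.iso (π a) (ρ.cap (inv_mul_cancel a) x.of)).symm)
      fun {x y} f => by
        have h := ρ.cap_push (inv_mul_cancel a) hs (one_mul (π a)).symm rfl f
        rw [push_eq_ofOne] at h
        exact (Iso.eq_inv_comp _).mpr ((Category.assoc _ _ _).symm.trans
          ((Iso.comp_inv_eq _).mpr h.symm)))
    (NatIso.ofComponents (fun x => ρ.cap (mul_inv_cancel a) x)
      fun f => ρ.cap_naturality (mul_inv_cancel a) f)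

instance (a : G) : (ρ.F a).IsEquivalence := (ρ.equiv a).isEquivalence_functor

lemma actMap_id (g : π.ker) (x : V) : ρ.actMap g (𝟙 x) = 𝟙 _ := (ρ.act g).map_id x

lemma actMap_units_smul (g : π.ker) {x y : V} (c : kˣ) (f : x ⟶ y) :
    ρ.actMap g (c • f) = c • ρ.actMap g f :=
  ρ.actMap_smul g (c : k) f

lemma actMap_iso_hom (g : π.ker) {x y : V} (e : x ≅ y) :
    ρ.actMap g e.hom = (ρ.F g).map (Signed.iso (π g) e).hom := by
  refine congrArg (ρ.F g).map ?_
  ext h <;> [rfl; exact absurd h (ker_ne _)]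

lemma actMap_map {a : G} (w : π.ker) {x y : V} (f : (⟨x⟩ : Signed (π a) V) ⟶ ⟨y⟩)
    (h : π a = π w * π a) :
    ρ.actMap w ((ρ.F a).map f) = (ρ.F w).map (Signed.push (ρ.F a) h f) := by
  refine congrArg (ρ.F w).map ?_
  ext h' <;> [rfl; exact absurd h' (ker_ne _)]

lemma actMap_actMap_comp_cap {u u' : π.ker} (h : (u : G) * u' = 1) {x y : V} (f : x ⟶ y) :
    ρ.actMap u (ρ.actMap u' f) ≫ (ρ.cap h y).hom = (ρ.cap h x).hom ≫ f := by
  rw [← ρ.cap_naturality h f, push_ker]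
  refine congrArg (· ≫ _) (congrArg (ρ.F u).map ?_)
  ext h' <;> [rfl; exact absurd h' (ker_ne _)]

lemma ev_iso {g : π.ker} (φ : ρ.Tr g) {x y : V} (e : x ≅ y) :
    ρ.ev φ y = e.inv ≫ ρ.ev φ x ≫ ρ.actMap g e.hom := by
  rw [Iso.eq_inv_comp, ev_naturality]

lemma ev_units_smul {g : π.ker} (c : kˣ) (φ : ρ.Tr g) (x : V) :
    ρ.ev (c • φ) x = c • ρ.ev φ x := rfl

lemma Tr_ext {g : π.ker} {φ φ' : ρ.Tr g} (h : ∀ x, ρ.ev φ x = ρ.ev φ' x) : φ = φ' :=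
  NatTrans.ext (funext h)

lemma Tr_ext_of_essSurj {C : Type*} [Category* C] (P : C ⥤ V) [P.EssSurj] {g : π.ker}
    {φ φ' : ρ.Tr g} (h : ∀ x, ρ.ev φ (P.obj x) = ρ.ev φ' (P.obj x)) : φ = φ' := by
  refine ρ.Tr_ext fun x => ?_
  rw [ρ.ev_iso φ (P.objObjPreimageIso x), ρ.ev_iso φ' (P.objObjPreimageIso x), h]

/-- The transformation `1 ⟶ ^ε ρ(u)` induced by `φ : 1 ⟶ ρ(g)`, for `u = g ^ ε`. It is
`TwistedRep.twist` with the sign and the power of `g` as independent variables. -/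
def signTwist (ε : ℤˣ) {g u : π.ker} (hu : u = g ^ (ε : ℤ)) (φ : ρ.Tr g) (x : V) :
    (⟨x⟩ : Signed ε V) ⟶ ⟨(ρ.F u).obj ⟨x⟩⟩ where
  pos h := ρ.ev φ x ≫ (castIso ρ.F (a := ↑g) (by simp [hu, h]) rfl).hom
  neg h := ρ.actMap u (ρ.ev φ x) ≫ (ρ.cap (a := ↑u) (b := ↑g) (by simp [hu, h]) x).hom

lemma castIso_comp_actMap_ev_comp_cap {g u u' : π.ker} (h : (u : G) = u') (h' : (u' : G) * g = 1)
    (φ : ρ.Tr g) (x : V) :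
    (castIso ρ.F h rfl).hom ≫ ρ.actMap u' (ρ.ev φ x) ≫ (ρ.cap h' x).hom =
      ρ.actMap u (ρ.ev φ x) ≫ (ρ.cap (h ▸ h') x).hom := by
  obtain rfl : u = u' := Subtype.ext h
  simp [castIso]

lemma twist_eq_signTwist (ω : G) {g : π.ker} (φ : ρ.Tr g) (x : V) :
    ρ.twist ω φ x = ρ.signTwist (π ω) rfl φ x := by
  ext h
  · rfl
  · exact ρ.castIso_comp_actMap_ev_comp_cap _ _ φ x

lemma signTwist_eq_ofOne {ε : ℤˣ} (hε : ε = 1) {g : π.ker} (hu : g = g ^ (ε : ℤ)) (φ : ρ.Tr g)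
    (x : V) : ρ.signTwist ε hu φ x = Signed.ofOne hε (ρ.ev φ x) := by
  ext h
  · simp [signTwist, castIso]
  · exact absurd (hε.symm.trans h) (by decide)

lemma slide_eq {ω m : G} {g g' u : π.ker} (h : ω * ↑(g ^ (π ω : ℤ)) = ↑g' * ω)
    (hu : u = g ^ (π ω : ℤ)) (hm : ω * u = m) (hm' : g' * ω = m) (φ : ρ.Tr g) (y : V) :
    ρ.slide h φ y = (ρ.F ω).map (ρ.signTwist (π ω) hu φ y) ≫ (ρ.mu hm y).hom ≫
      (ρ.mu hm' y).inv := by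
  subst hu hm'
  rw [slide, twist_eq_signTwist]
  simp [mu, castIso]

lemma ev_beta_obj {ω : G} {g g' : π.ker} (h : ω * ↑(g ^ (π ω : ℤ)) = ↑g' * ω) (φ : ρ.Tr g)
    (y : V) : ρ.ev (ρ.beta h φ) ((ρ.F ω).obj ⟨y⟩) = ρ.slide h φ y := by
  change ρ.betaApp h φ _ = _
  have hnat := ρ.slide_naturality h φ (Signed.iso (π ω) (ρ.cap (inv_mul_cancel ω) y)).hom
  rw [ρ.map_cap_eq_smul_cap (mul_inv_cancel ω), actMap_units_smul, Linear.units_smul_comp,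
    Linear.comp_units_smul] at hnat
  rw [betaApp, ← smul_left_cancel _ hnat, Iso.inv_hom_id_assoc]

end TwistedRep

/-! ### Composition of the operators `β` -/

namespace TwistedCocycle

variable {G : Type*} [Group G] {π : G →* ℤˣ} {k : Type*} [CommRing k]

/-- The scalar that compares `signTwist δ` of `β_{g, a}(φ)` with `signTwist (δ π(a))` of `φ`. It
consists of the factors of `tauRef b a g` that depend on `b` only through its degree `δ`. -/
def twistCoeff (α : TwistedCocycle π k) (δ : ℤˣ) (a g : G) : kˣ :=
  (if δ = -1 ∧ π a = -1 then α.val g g⁻¹ g else 1) *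
  (α.val (a * g ^ (-π a : ℤ) * a⁻¹) (a * g ^ (π a : ℤ) * a⁻¹) a *
      α.val a (g ^ (-π a : ℤ)) (g ^ (π a : ℤ)) /
      α.val (a * g ^ (-π a : ℤ) * a⁻¹) a (g ^ (π a : ℤ))) ^ (((δ : ℤ) - 1) / 2)

lemma twistCoeff_one (α : TwistedCocycle π k) (a g : G) : α.twistCoeff 1 a g = 1 := by
  simp [twistCoeff, show (1 : ℤˣ) ≠ -1 by decide]

lemma twistCoeff_neg_one (α : TwistedCocycle π k) {a g g₁ : G} (h : g₁ * a = a * g ^ (π a : ℤ)) :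
    α.twistCoeff (-1) a g = (if π a = -1 then α.val g g⁻¹ g else 1) *
      (α.val g₁⁻¹ g₁ a * α.val a (g ^ (-π a : ℤ)) (g ^ (π a : ℤ)) /
        α.val g₁⁻¹ a (g ^ (π a : ℤ)))⁻¹ := by
  obtain rfl : g₁ = a * g ^ (π a : ℤ) * a⁻¹ := eq_mul_inv_of_mul_eq h
  have hinv : (a * g ^ (π a : ℤ) * a⁻¹)⁻¹ = a * g ^ (-π a : ℤ) * a⁻¹ := by group
  rw [hinv]
  simp [twistCoeff]

lemma tauRef_eq_twistCoeff_mul (α : TwistedCocycle π k) {a b g g₂ u w : G}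
    (hu : u = g ^ (π (b * a) : ℤ)) (hw : w * a = a * u) (h₂ : g₂ * (b * a) = b * a * u) :
    α.tauRef b a g = α.twistCoeff (π b) a g * (α.val b a u * α.val g₂ b a / α.val b w a) := by
  rw [tauRef, twistCoeff, ← hu, ← hw, ← h₂, mul_inv_cancel_right, mul_inv_cancel_right]

end TwistedCocycle

namespace TwistedRep

variable {G : Type*} [Group G] {π : G →* ℤˣ} {k : Type*} [CommRing k] {α : TwistedCocycle π k}
  {V : Type*} [Category* V] [Preadditive V] [Linear k V] (ρ : TwistedRep α V)

lemma actMap_comp_castIso_comp_cap {u u' v : π.ker} (h : (u' : G) = v) (hu : (u : G) * u' = 1)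
    (x : V) (f : x ⟶ (ρ.F u').obj ⟨x⟩) :
    ρ.actMap u (f ≫ (castIso ρ.F h rfl).hom) ≫ (ρ.cap (h ▸ hu) x).hom =
      ρ.actMap u f ≫ (ρ.cap hu x).hom := by
  obtain rfl : u' = v := Subtype.ext h
  simp [castIso]

lemma cap_inv_comp_actMap_actMap_ev_comp_cap {g u u' : π.ker} (hu : (g : G) = u) (hu' : u' = g⁻¹)
    (h : (u : G) * u' = 1) (h' : (u' : G) * g = 1) (φ : ρ.Tr g) (x : V) :
    (ρ.cap h x).inv ≫ ρ.actMap u (ρ.actMap u' (ρ.ev φ x) ≫ (ρ.cap h' x).hom) =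
      α.val g (g : G)⁻¹ g • (ρ.ev φ x ≫ (castIso ρ.F hu rfl).hom) := by
  obtain rfl : g = u := Subtype.ext hu
  subst hu'
  rw [actMap_comp, actMap_iso_hom, ρ.map_cap_eq_smul_cap h h' x, Linear.comp_units_smul,
    ρ.actMap_actMap_comp_cap h, Linear.comp_units_smul, Iso.inv_hom_id_assoc]
  simp [castIso]

lemma push_signTwist_comp_cap {ε γ : ℤˣ} (hγ : γ = -ε) {g u u' : π.ker} (hu : u = g ^ (γ : ℤ))
    (hu' : u' = g ^ (ε : ℤ)) (h : (u : G) * u' = 1) (hs : ε = ε * π (u : G)) (φ : ρ.Tr g) (x : V) :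
    Signed.push (ρ.F u) hs (ρ.signTwist ε hu' φ x) ≫ (Signed.iso ε (ρ.cap h x)).hom =
      (if ε = -1 then α.val g (g : G)⁻¹ g else 1) • Signed.flip hγ (ρ.signTwist γ hu φ x) := by
  rw [push_ker]
  ext h'
  · have hgu : (g : G) = u' := by simp [hu', h']
    rw [if_neg (by rw [h']; decide), one_smul]
    exact ρ.actMap_comp_castIso_comp_cap hgu (hgu ▸ h) x (ρ.ev φ x)
  · rw [if_pos h']
    exact ρ.cap_inv_comp_actMap_actMap_ev_comp_cap (by simp [hu, hγ, h']) (by simp [hu', h'])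
      h _ φ x

lemma map_mu_inv_comp_cap {a b c q : G} (hab : a * b = 1) (hbc : b * c = q) (hq : a * q = c)
    (x : V) :
    (ρ.F a).map (Signed.iso (π a) (ρ.mu hbc x)).inv ≫ (ρ.cap hab ((ρ.F c).obj ⟨x⟩)).hom =
      (α.val a b c)⁻¹ • (ρ.mu hq x).hom := by
  rw [cap_hom_obj, ρ.map_mu_inv_comp_mu hab hbc (one_mul c) hq]

lemma map_signTwist_comp_mu {a m : G} {g u u' : π.ker} {γ : ℤˣ} (hu' : u' = g ^ (π a : ℤ))
    (hγ : γ = -π a) (hu : u = g ^ (γ : ℤ)) (hm : a * u = m) (hmu : m * u' = a) (hma : π a = π m)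
    (φ : ρ.Tr g) (y : V) :
    (ρ.F m).map (Signed.recast hma (ρ.signTwist (π a) hu' φ y)) ≫ (ρ.mu hmu y).hom =
      ((α.val a u u')⁻¹ * (if π a = -1 then α.val g (g : G)⁻¹ g else 1)) •
        ((ρ.mu hm y).inv ≫ (ρ.F a).map (Signed.flip hγ (ρ.signTwist γ hu φ y))) := by
  have huu : (u : G) * u' = 1 := by
    rw [hu, hu', hγ]; push_cast; rw [← zpow_add, neg_add_cancel, zpow_zero]
  have hs : π a = π a * π (u : G) := sign_coe a u
  have mu_comp_mu : (ρ.mu hm ((ρ.F u').obj ⟨y⟩)).hom ≫ (ρ.mu hmu y).hom =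
      (α.val a u u')⁻¹ • (ρ.F a).map (Signed.iso (π a) (ρ.cap huu y)).hom := by
    rw [map_cap_hom, ρ.mu_assoc hm huu hmu (mul_one a), inv_smul_smul]
  rw [eq_comm, ← Linear.comp_units_smul, Iso.inv_comp_eq, ← Category.assoc,
    ← ρ.mu_nat hm hs hma (ρ.signTwist (π a) hu' φ y), Category.assoc, mu_comp_mu,
    Linear.comp_units_smul, ← Functor.map_comp, ρ.push_signTwist_comp_cap hγ hu hu' huu hs φ y,
    Functor.map_units_smul, smul_smul]

lemma actMap_slide_comp_cap {a m : G} {g g₁ w u u' : π.ker} {γ : ℤˣ}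
    (h : a * ↑(g ^ (π a : ℤ)) = ↑g₁ * a) (hu' : u' = g ^ (π a : ℤ)) (hγ : γ = -π a)
    (hu : u = g ^ (γ : ℤ)) (hw : (w : G) * g₁ = 1) (hm : a * u = m) (hm' : w * a = m)
    (φ : ρ.Tr g) (y : V) :
    ρ.actMap w (ρ.slide h φ y) ≫ (ρ.cap hw ((ρ.F a).obj ⟨y⟩)).hom =
      ((if π a = -1 then α.val g (g : G)⁻¹ g else 1) *
        (α.val w g₁ a * α.val a u u' / α.val w a u')⁻¹) •
        ((ρ.mu hm' y).hom ≫ (ρ.mu hm y).inv ≫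
          (ρ.F a).map (Signed.flip hγ (ρ.signTwist γ hu φ y))) := by
  have hq : (a * u' : G) = g₁ * a := by rw [hu', h]
  have hwq : (w : G) * (g₁ * a) = a := by rw [← mul_assoc, hw, one_mul]
  have hmu : m * u' = a := by rw [← hm', mul_assoc, hq, hwq]
  have hma : π a = π m := by rw [← hm, map_mul, ← sign_coe a u]
  have hwa : π a = π (w : G) * π a := by rw [MonoidHom.mem_ker.mp w.2, one_mul]
  have actMap_mu_inv : ρ.actMap w (ρ.mu (rfl : (g₁ : G) * a = _) y).inv =
      (ρ.F w).map (Signed.iso (π w) (ρ.mu (rfl : (g₁ : G) * a = _) y)).inv :=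
    ρ.actMap_iso_hom w (ρ.mu rfl y).symm
  rw [ρ.slide_eq h hu' hq rfl, actMap_comp, actMap_comp, Category.assoc, Category.assoc,
    actMap_mu_inv, ρ.map_mu_inv_comp_cap hw rfl hwq, Linear.comp_units_smul, actMap_iso_hom,
    ρ.mu_assoc hm' hq hmu hwq y, Linear.comp_units_smul, Linear.comp_units_smul,
    ρ.actMap_map w _ hwa, reassoc_of% ρ.mu_nat hm' hwa hma (ρ.signTwist (π a) hu' φ y),
    ρ.map_signTwist_comp_mu hu' hγ hu hm hmu hma, Linear.comp_units_smul, smul_smul, smul_smul]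
  congr 1
  rw [div_eq_mul_inv, mul_inv, mul_inv, inv_inv]
  ac_rfl

lemma signTwist_beta {δ γ : ℤˣ} {a m : G} {g g₁ w u : π.ker} (hγ : γ = δ * π a)
    (h : a * ↑(g ^ (π a : ℤ)) = ↑g₁ * a) (hw : w = g₁ ^ (δ : ℤ)) (hu : u = g ^ (γ : ℤ))
    (hm : a * u = m) (hm' : w * a = m) (φ : ρ.Tr g) (y : V) :
    ρ.signTwist δ hw (ρ.beta h φ) ((ρ.F a).obj ⟨y⟩) =
      α.twistCoeff δ a g • (Signed.push (ρ.F a) hγ (ρ.signTwist γ hu φ y) ≫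
        (Signed.iso δ (ρ.mu hm y ≪≫ (ρ.mu hm' y).symm)).hom) := by
  ext hδ
  · have hcoeff : α.twistCoeff δ a g = 1 := by rw [hδ, α.twistCoeff_one]
    obtain rfl : w = g₁ := by simp [hw, hδ]
    obtain rfl : γ = π a := by rw [hγ, hδ, one_mul]
    rw [hcoeff, one_smul, ρ.signTwist_eq_ofOne hδ, ρ.ev_beta_obj h φ y,
      ρ.slide_eq h hu hm hm' φ y]
    rfl
  · have hwg : (w : G) * g₁ = 1 := by simp [hw, hδ]
    have hcoe : (w : G) = (g₁ : G)⁻¹ := by simp [hw, hδ]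
    have hγa : γ = -π a := by rw [hγ, hδ, neg_one_mul]
    have hua : (u : G) = g ^ (-π a : ℤ) := by rw [hu, hγa]; rfl
    have hcoeff : α.twistCoeff δ a g = (if π a = -1 then α.val g (g : G)⁻¹ g else 1) *
        (α.val w g₁ a * α.val a u ↑(g ^ (π a : ℤ)) / α.val w a ↑(g ^ (π a : ℤ)))⁻¹ := by
      rw [hδ, α.twistCoeff_neg_one h.symm, hcoe, hua]
      rfl
    have hslide := ρ.actMap_slide_comp_cap h rfl hγa hu hwg hm hm' φ y
    rw [← ρ.ev_beta_obj] at hslide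
    rw [hcoeff]
    exact hslide.trans (congrArg (_ • ·) (Category.assoc _ _ _).symm)

lemma beta_beta {a b : G} {g g₁ g₂ : π.ker} (h₁ : a * ↑(g ^ (π a : ℤ)) = ↑g₁ * a)
    (h₂ : b * ↑(g₁ ^ (π b : ℤ)) = ↑g₂ * b)
    (h : b * a * ↑(g ^ (π (b * a) : ℤ)) = ↑g₂ * (b * a)) (φ : ρ.Tr g) :
    ρ.beta h₂ (ρ.beta h₁ φ) = α.tauRef b a g • ρ.beta h φ := by
  obtain ⟨u, hu⟩ : ∃ u : π.ker, u = g ^ (π (b * a) : ℤ) := ⟨_, rfl⟩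
  obtain ⟨w, hw⟩ : ∃ w : π.ker, w = g₁ ^ (π b : ℤ) := ⟨_, rfl⟩
  have hbw : b * w = g₂ * b := by rw [hw, h₂]
  have hbau : b * a * u = g₂ * (b * a) := by rw [hu, h]
  have hwa : w * a = a * u := by
    apply mul_left_cancel (a := b)
    rw [← mul_assoc, hbw, mul_assoc, ← hbau, mul_assoc]
  have hb : b * (a * u) = g₂ * (b * a) := by rw [← mul_assoc, hbau]
  refine ρ.Tr_ext_of_essSurj (ρ.F (b * a)) fun ⟨y⟩ => ?_
  rw [ev_units_smul, ρ.ev_beta_obj h, ρ.slide_eq h hu hbau rfl,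
    ρ.ev_iso _ (ρ.mu (rfl : b * a = _) y), ρ.ev_beta_obj h₂, ρ.slide_eq h₂ hw hbw rfl,
    ρ.signTwist_beta (π.map_mul b a) h₁ hw hu rfl hwa, actMap_iso_hom,
    α.tauRef_eq_twistCoeff_mul (congrArg Subtype.val hu) hwa hbau.symm]
  simp only [Functor.map_units_smul, Functor.map_comp, ← iso_trans_hom, Category.assoc,
    Linear.units_smul_comp, Linear.comp_units_smul]
  have map_mu_inv_comp_mu_comp_mu : (ρ.F b).map (Signed.iso (π b) (ρ.mu hwa y).symm).hom ≫
      (ρ.mu hbw ((ρ.F a).obj ⟨y⟩)).hom ≫ (ρ.mu (mul_assoc _ _ _) y).hom =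
        (α.val b w a)⁻¹ • (ρ.mu hb y).hom := ρ.map_mu_inv_comp_mu hbw hwa _ hb y
  rw [ρ.mu_inv_comp_map_mu (rfl : (g₂ : G) * b = _) rfl (mul_assoc _ _ _) rfl y]
  simp only [Linear.comp_units_smul]
  rw [reassoc_of% map_mu_inv_comp_mu_comp_mu, Linear.units_smul_comp]
  simp only [Linear.comp_units_smul]
  rw [reassoc_of% ρ.mu_assoc (rfl : b * a = _) (rfl : a * u = _) hbau hb y,
    Linear.units_smul_comp]
  simp only [Linear.comp_units_smul, Category.assoc]
  rw [reassoc_of% ρ.mu_nat (rfl : b * a = _) (π.map_mul b a) rfl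
    (ρ.signTwist (π (b * a)) hu φ y), Iso.inv_hom_id_assoc]
  simp only [smul_smul]
  refine congrArg (· • _) ?_
  rw [div_eq_mul_inv]
  ac_rfl

lemma beta_comp {a b : G} {g g₁ g₂ : π.ker} (h₁ : a * ↑(g ^ (π a : ℤ)) = ↑g₁ * a)
    (h₂ : b * ↑(g₁ ^ (π b : ℤ)) = ↑g₂ * b)
    (h : b * a * ↑(g ^ (π (b * a) : ℤ)) = ↑g₂ * (b * a)) :
    ρ.beta h₂ ∘ₗ ρ.beta h₁ = α.tauRef b a g • ρ.beta h :=
  LinearMap.ext (ρ.beta_beta h₁ h₂ h)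

lemma beta_one {g : π.ker} (h : 1 * ↑(g ^ (π 1 : ℤ)) = ↑g * (1 : G)) :
    ρ.beta h = LinearMap.id := by
  have hu : g = g ^ ((π 1 : ℤˣ) : ℤ) := by simp
  refine LinearMap.ext fun φ => ρ.Tr_ext_of_essSurj (ρ.F 1) fun ⟨y⟩ => ?_
  rw [ρ.ev_beta_obj, ρ.slide_eq h hu (one_mul _) (mul_one _), signTwist_eq_ofOne _ π.map_one,
    mu_one_left, ← Category.assoc, ρ.ψe_nat, Category.assoc, ← Category.assoc, Iso.comp_inv_eq,
    mu_one_right, ← actMap_iso_hom, ev_naturality]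
  rfl

lemma beta_congr {ω ω' : G} (hω : ω = ω') {g g' : π.ker} (h : ω * ↑(g ^ (π ω : ℤ)) = ↑g' * ω)
    (h' : ω' * ↑(g ^ (π ω' : ℤ)) = ↑g' * ω') : ρ.beta h = ρ.beta h' := by
  subst hω; rfl

lemma beta_comp_of_mul_eq_one {σ τ : G} (hτσ : τ * σ = 1) {g g' : π.ker}
    (hσ : σ * ↑(g ^ (π σ : ℤ)) = ↑g' * σ) (hτ : τ * ↑(g' ^ (π τ : ℤ)) = ↑g * τ) :
    ρ.beta hτ ∘ₗ ρ.beta hσ = α.tauRef τ σ g • LinearMap.id := by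
  rw [ρ.beta_comp hσ hτ (by simp [hτσ]), ρ.beta_congr hτσ _ (by simp), beta_one]

lemma inv_rel {σ : G} {g g' : π.ker} (h : σ * ↑(g ^ (π σ : ℤ)) = ↑g' * σ) :
    σ⁻¹ * ↑(g' ^ (π σ⁻¹ : ℤ)) = ↑g * σ⁻¹ := by
  have hg' : (g' : G) = σ * ↑(g ^ (π σ : ℤ)) * σ⁻¹ := eq_mul_inv_of_mul_eq h.symm
  rcases Int.units_eq_one_or (π σ) with hσ | hσ <;> simp [hσ, hg', mul_assoc]

lemma beta_bijective {σ : G} {g g' : π.ker} (h : σ * ↑(g ^ (π σ : ℤ)) = ↑g' * σ) :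
    Function.Bijective (ρ.beta h) := by
  have left_inv := LinearMap.congr_fun
    (ρ.beta_comp_of_mul_eq_one (inv_mul_cancel σ) h (inv_rel h))
  have right_inv := LinearMap.congr_fun
    (ρ.beta_comp_of_mul_eq_one (mul_inv_cancel σ) (inv_rel h) h)
  constructor
  · refine Function.LeftInverse.injective
      (g := fun θ => (α.tauRef σ⁻¹ σ g)⁻¹ • ρ.beta (inv_rel h) θ) fun φ => ?_
    exact inv_smul_eq_iff.mpr (left_inv φ)
  · refine fun θ => ⟨(α.tauRef σ σ⁻¹ g')⁻¹ • ρ.beta (inv_rel h) θ, ?_⟩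
    rw [LinearMap.map_smul_of_tower]
    exact inv_smul_eq_iff.mpr (right_inv θ)

lemma conj_rel (p : GComm π) (σ : G) : σ * ↑(p.g ^ (π σ : ℤ)) = ↑(p.conj σ).g * σ := by
  simp [GComm.conj]

lemma beta_conj_comp (p : GComm π) (σ : G) :
    ρ.beta (p.conj σ).comm ∘ₗ ρ.beta (conj_rel p σ) =
      α.tautau σ p • (ρ.beta (conj_rel p σ) ∘ₗ ρ.beta p.comm) := by
  have mul_rel : σ * p.ω * ↑(p.g ^ (π (σ * p.ω) : ℤ)) = ↑(p.conj σ).g * (σ * p.ω) := by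
    have hσ := conj_rel p σ
    have hω := (SemiconjBy.zpow_right (a := p.ω) p.comm (π σ : ℤ)).eq
    push_cast at hσ hω ⊢
    rw [← mul_assoc (p.conj σ).g.1, ← hσ, mul_assoc, mul_assoc, ← hω, map_mul, Units.val_mul,
      mul_comm (π σ : ℤ), zpow_mul]
  have hmul : (p.conj σ).ω * σ = σ * p.ω := by simp [GComm.conj]
  rw [ρ.beta_comp (conj_rel p σ) (p.conj σ).comm (by rw [hmul]; exact mul_rel),
    ρ.beta_comp p.comm (conj_rel p σ) mul_rel, ρ.beta_congr hmul _ mul_rel, smul_smul,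
    TwistedCocycle.tautau]
  congr 1
  exact (div_mul_cancel _ _).symm

end TwistedRep

/-! ### The blocks of the induced representation -/

namespace Signed

/-- An endomorphism of `x`, read as an endomorphism in `^ε C`. -/
@[simps]
def endo (ε : ℤˣ) {C : Type*} [Category* C] {x : C} (f : x ⟶ x) :
    (⟨x⟩ : Signed ε C) ⟶ ⟨x⟩ where
  pos _ := f
  neg _ := f

lemma push_zero {γ δ ε : ℤˣ} {C D : Type*} [Category* C] [Category* D] [Preadditive C]
    [Preadditive D] (F : Signed ε C ⥤ D) [F.Additive] (h : γ = δ * ε) (x y : C) :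
    push F h (0 : (⟨x⟩ : Signed γ C) ⟶ ⟨y⟩) = 0 := by
  ext <;> exact F.map_zero _ _

end Signed

namespace TwistedRep

variable {G : Type*} [Group G] {π : G →* ℤˣ} {k : Type*} [CommRing k] {α : TwistedCocycle π k}
  {V : Type*} [Category* V] [Preadditive V] [Linear k V] (ρ : TwistedRep α V)

/-- The action of the endomorphisms of the identity functor on the categorical trace. -/
def centerAct (z : 𝟭 V ⟶ 𝟭 V) (g : π.ker) : ρ.Tr g →ₗ[k] ρ.Tr g where
  toFun φ := z ≫ φ
  map_add' _ _ := Preadditive.comp_add _ _ _ _ _ _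
  map_smul' _ _ := Linear.comp_smul _ _ _ _ _ _

lemma ev_centerAct (z : 𝟭 V ⟶ 𝟭 V) {g : π.ker} (φ : ρ.Tr g) (x : V) :
    ρ.ev (ρ.centerAct z g φ) x = z.app x ≫ ρ.ev φ x := rfl

lemma centerAct_comp (z z' : 𝟭 V ⟶ 𝟭 V) (g : π.ker) :
    ρ.centerAct z g ∘ₗ ρ.centerAct z' g = ρ.centerAct (z ≫ z') g :=
  LinearMap.ext fun φ => (Category.assoc z z' φ).symm

lemma centerAct_eq_of_actMap_app {z z' : 𝟭 V ⟶ 𝟭 V} {g : π.ker}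
    (hz : ∀ x, ρ.actMap g (z.app x) = z'.app ((ρ.F g).obj ⟨x⟩)) :
    ρ.centerAct z g = ρ.centerAct z' g := by
  refine LinearMap.ext fun φ => ρ.Tr_ext fun x => ?_
  calc z.app x ≫ ρ.ev φ x = ρ.ev φ x ≫ ρ.actMap g (z.app x) := ρ.ev_naturality φ (z.app x)
    _ = ρ.ev φ x ≫ z'.app ((ρ.F g).obj ⟨x⟩) := by rw [hz]
    _ = z'.app x ≫ ρ.ev φ x := z'.naturality (ρ.ev φ x)

lemma twist_centerAct (ω : G) (z : 𝟭 V ⟶ 𝟭 V) {g : π.ker} (φ : ρ.Tr g) (x : V) :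
    ρ.twist ω (ρ.centerAct z g φ) x = Signed.endo (π ω) (z.app x) ≫ ρ.twist ω φ x := by
  ext h
  · exact Category.assoc _ _ _
  · have hnat : z.app x ≫ ρ.ev φ x = ρ.ev φ x ≫ ρ.actMap g (z.app x) :=
      ρ.ev_naturality φ (z.app x)
    have hcap := ρ.actMap_actMap_comp_cap (u := g⁻¹) (u' := g) (by simp) (z.app x)
    simp only [twist, ev_centerAct, Signed.comp_neg, Signed.endo_neg, Category.assoc]
    rw [hnat, actMap_comp, Category.assoc]
    exact congrArg (fun f => _ ≫ _ ≫ f) hcap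

lemma beta_centerAct {ω : G} {z z' : 𝟭 V ⟶ 𝟭 V}
    (hz : ∀ x, (ρ.F ω).map (Signed.endo (π ω) (z.app x)) = z'.app ((ρ.F ω).obj ⟨x⟩))
    {g g' : π.ker} (h : ω * ↑(g ^ (π ω : ℤ)) = ↑g' * ω) :
    ρ.beta h ∘ₗ ρ.centerAct z g = ρ.centerAct z' g' ∘ₗ ρ.beta h := by
  refine LinearMap.ext fun φ => ρ.Tr_ext_of_essSurj (ρ.F ω) fun ⟨y⟩ => ?_
  calc ρ.ev (ρ.beta h (ρ.centerAct z g φ)) ((ρ.F ω).obj ⟨y⟩)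
      = (ρ.F ω).map (Signed.endo (π ω) (z.app y)) ≫ ρ.slide h φ y := by
        rw [ev_beta_obj, slide, slide, twist_centerAct, Functor.map_comp, Category.assoc]
    _ = z'.app ((ρ.F ω).obj ⟨y⟩) ≫ ρ.ev (ρ.beta h φ) ((ρ.F ω).obj ⟨y⟩) := by
        rw [ev_beta_obj, hz]

end TwistedRep

namespace SProd

variable {ι : Type*} {ε : ι → ℤˣ} {V : Type*} [Category* V] [Preadditive V]

open Classical in
/-- The projection onto the factor `j`, as an endomorphism of the identity functor. -/
noncomputable def proj (j : ι) : 𝟭 (SProd ε V) ⟶ 𝟭 (SProd ε V) where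
  app x := ⟨fun i => if i = j then 𝟙 _ else 0⟩
  naturality x y f := hom_ext fun i => by
    by_cases h : i = j <;> simp [h]

lemma proj_app_self (j : ι) (x : SProd ε V) : ((proj j).app x).app j = 𝟙 _ := if_pos rfl

lemma proj_app_of_ne {i j : ι} (h : i ≠ j) (x : SProd ε V) : ((proj j).app x).app i = 0 :=
  if_neg h

lemma proj_app_comp_app_self (j : ι) {x y : SProd ε V} (f : x ⟶ y) :
    ((proj j).app x ≫ f).app j = f.app j :=
  (congrArg (· ≫ f.app j) (proj_app_self j x)).trans (Category.id_comp _)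

lemma proj_app_comp_app_of_ne {i j : ι} (h : i ≠ j) {x y : SProd ε V} (f : x ⟶ y) :
    ((proj j).app x ≫ f).app i = 0 :=
  (congrArg (· ≫ f.app i) (proj_app_of_ne h x)).trans Limits.zero_comp

lemma proj_comp_of_ne {i j : ι} (h : i ≠ j) : proj (ε := ε) (V := V) i ≫ proj j = 0 := by
  ext x
  refine hom_ext fun l => ?_
  by_cases hl : l = i
  · subst hl
    exact (proj_app_comp_app_self l _).trans (proj_app_of_ne h x)
  · exact proj_app_comp_app_of_ne hl _

lemma proj_comp_self (j : ι) : proj (ε := ε) (V := V) j ≫ proj j = proj j := by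
  ext x
  refine hom_ext fun l => ?_
  by_cases hl : l = j
  · subst hl
    exact proj_app_comp_app_self l _
  · exact (proj_app_comp_app_of_ne hl _).trans (proj_app_of_ne hl x).symm

lemma coord_endo_proj_of_eq {γ δ : ℤˣ} {i j : ι} (hij : i = j) (x : SProd ε V)
    (h : γ = δ * ε i) : coord (Signed.endo δ ((proj j).app x)) i h = 𝟙 _ := by
  subst hij
  refine Eq.trans ?_ (coord_id (x := x) i h)
  unfold coord
  split_ifs <;> simp only [Signed.endo, proj_app_self] <;> rfl

lemma coord_endo_proj_of_ne {γ δ : ℤˣ} {i j : ι} (hij : i ≠ j) (x : SProd ε V)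
    (h : γ = δ * ε i) : coord (Signed.endo δ ((proj j).app x)) i h = 0 := by
  unfold coord
  split_ifs <;> simp only [Signed.endo, proj_app_of_ne hij] <;> rfl

lemma sum_app {κ : Type*} (s : Finset κ) {x y : SProd ε V} (f : κ → (x ⟶ y)) (i : ι) :
    (∑ a ∈ s, f a).app i = ∑ a ∈ s, (f a).app i :=
  map_sum (⟨⟨fun u : x ⟶ y => u.app i, rfl⟩, fun _ _ => rfl⟩ : (x ⟶ y) →+ _) f s

lemma sum_proj [Fintype ι] : ∑ j, proj (ε := ε) (V := V) j = 𝟙 _ := by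
  ext x
  refine hom_ext fun i => ?_
  rw [NatTrans.app_sum, sum_app, Finset.sum_eq_single i]
  · exact proj_app_self i x
  · exact fun j _ hj => proj_app_of_ne hj.symm x
  · exact fun hi => absurd (Finset.mem_univ i) hi

end SProd

namespace RInd

variable {G : Type*} [Group G] {π : G →* ℤˣ} {H : Subgroup G} {k : Type*} [CommRing k]
  {α : TwistedCocycle π k} {V : Type*} [Category* V] [Preadditive V] [Linear k V]
  (ρ : TwistedRep (α.res H) V) (S : CosetReps H)

lemma F_map_endo_proj (ω : G) (j : G ⧸ H) (x : Cat π S V) :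
    (F ρ S ω).map (Signed.endo (π ω) ((SProd.proj j).app x)) =
      (SProd.proj (ω • j)).app ((F ρ S ω).obj ⟨x⟩) := by
  refine SProd.hom_ext fun i => ?_
  rw [F_map_app]
  by_cases h : ω⁻¹ • i = j
  · rw [SProd.coord_endo_proj_of_eq h, inv_smul_eq_iff.mp h, SProd.proj_app_self]
    exact Signed.push_id _ _ _
  · rw [SProd.proj_app_of_ne (mt inv_smul_eq_iff.mpr h), SProd.coord_endo_proj_of_ne h]
    exact Signed.push_zero _ _ _ _

/-- The projection of the categorical trace onto the factor `j`. -/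
noncomputable def block (g : π.ker) (j : G ⧸ H) : Module.End k ((RInd ρ S).Tr g) :=
  (RInd ρ S).centerAct (SProd.proj j) g

lemma beta_comp_block {ω : G} {g g' : π.ker} (h : ω * ↑(g ^ (π ω : ℤ)) = ↑g' * ω) (j : G ⧸ H) :
    (RInd ρ S).beta h ∘ₗ block ρ S g j = block ρ S g' (ω • j) ∘ₗ (RInd ρ S).beta h :=
  (RInd ρ S).beta_centerAct (F_map_endo_proj ρ S ω j) h

lemma block_comp_self (g : π.ker) (j : G ⧸ H) :
    block ρ S g j ∘ₗ block ρ S g j = block ρ S g j := by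
  rw [block, TwistedRep.centerAct_comp, SProd.proj_comp_self]

lemma block_comp_of_ne (g : π.ker) {i j : G ⧸ H} (h : i ≠ j) :
    block ρ S g i ∘ₗ block ρ S g j = 0 := by
  rw [block, block, TwistedRep.centerAct_comp, SProd.proj_comp_of_ne h]
  exact LinearMap.ext fun φ => Limits.zero_comp (f := φ)

lemma block_smul (g : π.ker) (j : G ⧸ H) : block ρ S g ((g : G) • j) = block ρ S g j := by
  refine ((RInd ρ S).centerAct_eq_of_actMap_app fun x => ?_).symm
  refine Eq.trans (congrArg (F ρ S g).map ?_) (F_map_endo_proj ρ S g j x)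
  ext h <;> [rfl; exact absurd h (TwistedRep.ker_ne _)]

lemma block_eq_zero_of_smul_ne (g : π.ker) {j : G ⧸ H} (h : (g : G) • j ≠ j) :
    block ρ S g j = 0 :=
  calc block ρ S g j = block ρ S g ((g : G) • j) ∘ₗ block ρ S g j := by
        rw [block_smul, block_comp_self]
    _ = 0 := block_comp_of_ne ρ S g h

lemma sum_block [Fintype (G ⧸ H)] (g : π.ker) : ∑ j, block ρ S g j = LinearMap.id := by
  refine LinearMap.ext fun φ => ?_
  rw [LinearMap.sum_apply, LinearMap.id_apply]
  calc ∑ j, block ρ S g j φ = (∑ j, SProd.proj j) ≫ φ := (Preadditive.sum_comp _ _ _).symm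
    _ = φ := by rw [SProd.sum_proj]; exact Category.id_comp φ

end RInd

/-! ### Intertwiners -/

/-- The functor `^ε P`, on morphisms. -/
@[simps]
def Signed.mapHom {ε : ℤˣ} {C D : Type*} [Category* C] [Category* D] (P : C ⥤ D) {x y : C}
    (f : (⟨x⟩ : Signed ε C) ⟶ ⟨y⟩) : (⟨P.obj x⟩ : Signed ε D) ⟶ ⟨P.obj y⟩ where
  pos h := P.map (f.pos h)
  neg h := P.map (f.neg h)

section Intertwiner

variable {G : Type*} [Group G] {π : G →* ℤˣ} {k : Type*} [CommRing k] {α : TwistedCocycle π k}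
  {W : Type*} [Category* W] [Preadditive W] [Linear k W]
  {V : Type*} [Category* V] [Preadditive V] [Linear k V]

/-- The restriction of a twisted Real `2`-representation to a subgroup. -/
@[simps]
def TwistedRep.res (ρ : TwistedRep α V) (H : Subgroup G) : TwistedRep (α.res H) V where
  F ω := ρ.F ω
  additive ω := ρ.additive ω
  linear ω := ρ.linear ω
  ψ ω₂ ω₁ x := ρ.ψ ω₂ ω₁ x
  ψ_nat ω₂ ω₁ _ _ f := ρ.ψ_nat ω₂ ω₁ f
  ψe x := ρ.ψe x
  ψe_nat f := ρ.ψe_nat f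
  assoc ω₃ ω₂ ω₁ x := ρ.assoc ω₃ ω₂ ω₁ x
  unit_left ω x := ρ.unit_left ω x
  unit_right ω x := ρ.unit_right ω x

/-- A `1`-morphism of twisted Real `2`-representations: a functor which commutes with the actions up
to coherent isomorphism. -/
structure Intertwiner (ρ₁ : TwistedRep α W) (ρ₂ : TwistedRep α V) where
  /-- the underlying functor -/
  P : W ⥤ V
  /-- the compatibility isomorphisms -/
  κ : ∀ (ω : G) (x : W), P.obj ((ρ₁.F ω).obj ⟨x⟩) ≅ (ρ₂.F ω).obj ⟨P.obj x⟩
  κ_nat : ∀ (ω : G) {x y : W} (f : (⟨x⟩ : Signed (π ω) W) ⟶ ⟨y⟩),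
    P.map ((ρ₁.F ω).map f) ≫ (κ ω y).hom = (κ ω x).hom ≫ (ρ₂.F ω).map (Signed.mapHom P f)
  κ_mul : ∀ (b a : G) (x : W), P.map (ρ₁.ψ b a x).hom ≫ (κ (b * a) x).hom =
    (κ b ((ρ₁.F a).obj ⟨x⟩)).hom ≫ (ρ₂.F b).map (Signed.iso (π b) (κ a x)).hom ≫
      (ρ₂.ψ b a (P.obj x)).hom
  κ_one : ∀ x : W, P.map (ρ₁.ψe x).hom = (κ 1 x).hom ≫ (ρ₂.ψe (P.obj x)).hom

namespace Intertwiner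

variable {ρ₁ : TwistedRep α W} {ρ₂ : TwistedRep α V} (Φ : Intertwiner ρ₁ ρ₂)

lemma κ_cast {a b : G} (h : a = b) (x : W) :
    Φ.P.map (castIso ρ₁.F h rfl).hom ≫ (Φ.κ b x).hom =
      (Φ.κ a x).hom ≫ (castIso ρ₂.F h rfl).hom := by
  subst h
  simp [castIso]

lemma κ_mu {a b c : G} (h : b * a = c) (x : W) :
    Φ.P.map (ρ₁.mu h x).hom ≫ (Φ.κ c x).hom =
      (Φ.κ b ((ρ₁.F a).obj ⟨x⟩)).hom ≫ (ρ₂.F b).map (Signed.iso (π b) (Φ.κ a x)).hom ≫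
        (ρ₂.mu h (Φ.P.obj x)).hom := by
  subst h
  simpa only [TwistedRep.mu_rfl] using Φ.κ_mul b a x

lemma κ_cap {a b : G} (h : b * a = 1) (x : W) :
    Φ.P.map (ρ₁.cap h x).hom =
      (Φ.κ b ((ρ₁.F a).obj ⟨x⟩)).hom ≫ (ρ₂.F b).map (Signed.iso (π b) (Φ.κ a x)).hom ≫
        (ρ₂.cap h (Φ.P.obj x)).hom := by
  have hmu := Φ.κ_mu h x
  rw [TwistedRep.cap_eq, TwistedRep.cap_eq, Iso.trans_hom, Iso.trans_hom, Functor.map_comp, κ_one,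
    reassoc_of% hmu]

lemma κ_actMap (g : π.ker) {x y : W} (f : x ⟶ y) :
    Φ.P.map (ρ₁.actMap g f) ≫ (Φ.κ g y).hom = (Φ.κ g x).hom ≫ ρ₂.actMap g (Φ.P.map f) := by
  refine (Φ.κ_nat g _).trans (congrArg (_ ≫ ·) (congrArg (ρ₂.F g).map ?_))
  ext h <;> [rfl; exact absurd h (TwistedRep.ker_ne _)]

/-- The elements `φ : 1 ⟶ ρ₁(g)` and `θ : 1 ⟶ ρ₂(g)` of the categorical traces correspond to each
other under `Φ`. -/
def Related {g : π.ker} (φ : ρ₁.Tr g) (θ : ρ₂.Tr g) : Prop :=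
  ∀ x, Φ.P.map (ρ₁.ev φ x) ≫ (Φ.κ g x).hom = ρ₂.ev θ (Φ.P.obj x)

section Related

variable {Φ} {g : π.ker} {φ : ρ₁.Tr g} {θ : ρ₂.Tr g}

lemma Related.signTwist (h : Φ.Related φ θ) {u : π.ker} {ε : ℤˣ} (hu : u = g ^ (ε : ℤ)) (x : W) :
    Signed.mapHom Φ.P (ρ₁.signTwist ε hu φ x) ≫ (Signed.iso ε (Φ.κ u x)).hom =
      ρ₂.signTwist ε hu θ (Φ.P.obj x) := by
  ext hε
  · have hcast := Φ.κ_cast (show (g : G) = u by simp [hu, hε]) x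
    simp only [Signed.comp_pos, TwistedRep.signTwist, Signed.mapHom_pos, Signed.iso_hom_pos,
      Functor.map_comp, Category.assoc, ← h x]
    rw [hcast]
  · have hact := Φ.κ_actMap u (ρ₁.ev φ x)
    simp only [Signed.comp_neg, TwistedRep.signTwist, Signed.mapHom_neg, Signed.iso_hom_neg,
      Functor.map_comp, κ_cap, ← h x]
    rw [reassoc_of% hact, Iso.inv_hom_id_assoc, TwistedRep.actMap_comp, Category.assoc,
      TwistedRep.actMap_iso_hom]

lemma map_mu_inv_comp_κ {a c : G} {w : π.ker} (h : (w : G) * a = c) (x : W) :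
    Φ.P.map (ρ₁.mu h x).inv ≫ (Φ.κ w ((ρ₁.F a).obj ⟨x⟩)).hom ≫ ρ₂.actMap w (Φ.κ a x).hom =
      (Φ.κ c x).hom ≫ (ρ₂.mu h (Φ.P.obj x)).inv := by
  rw [Iso.eq_comp_inv, Category.assoc, Category.assoc, TwistedRep.actMap_iso_hom, ← Φ.κ_mu h x,
    ← Functor.map_comp_assoc, Iso.inv_hom_id, CategoryTheory.Functor.map_id, Category.id_comp]

lemma Related.slide {ω : G} {g' : π.ker} (h : Φ.Related φ θ)
    (hω : ω * ↑(g ^ (π ω : ℤ)) = ↑g' * ω) (x : W) :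
    Φ.P.map (ρ₁.slide hω φ x) ≫ (Φ.κ g' ((ρ₁.F ω).obj ⟨x⟩)).hom ≫
        ρ₂.actMap g' (Φ.κ ω x).hom = (Φ.κ ω x).hom ≫ ρ₂.slide hω θ (Φ.P.obj x) := by
  have hmu := Φ.κ_mu hω x
  have hnat := Φ.κ_nat ω (ρ₁.signTwist (π ω) rfl φ x)
  have htwist := congrArg (ρ₂.F ω).map (h.signTwist rfl x)
  rw [Functor.map_comp] at htwist
  rw [ρ₁.slide_eq hω rfl hω rfl, ρ₂.slide_eq hω rfl hω rfl]
  simp only [Functor.map_comp, Category.assoc]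
  rw [map_mu_inv_comp_κ, reassoc_of% hmu, reassoc_of% hnat, reassoc_of% htwist]

lemma Related.beta {ω : G} {g' : π.ker} (h : Φ.Related φ θ)
    (hω : ω * ↑(g ^ (π ω : ℤ)) = ↑g' * ω) : Φ.Related (ρ₁.beta hω φ) (ρ₂.beta hω θ) := by
  intro x
  change Φ.P.map (ρ₁.betaApp hω φ x) ≫ _ = ρ₂.betaApp hω θ _
  have hslide := h.slide hω ((ρ₁.F ω⁻¹).obj ⟨x⟩)
  have hact := Φ.κ_actMap g' (ρ₁.cap (mul_inv_cancel ω) x).hom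
  have hcap := Φ.κ_cap (mul_inv_cancel ω) x
  have hnat := ρ₂.slide_naturality hω θ (Signed.iso (π ω) (Φ.κ ω⁻¹ x)).hom
  simp only [TwistedRep.betaApp, Functor.map_comp, Category.assoc]
  rw [hact, hcap, TwistedRep.actMap_comp, TwistedRep.actMap_comp, reassoc_of% hslide,
    ← reassoc_of% hnat, ← cancel_epi (Φ.P.map (ρ₁.cap (mul_inv_cancel ω) x).hom),
    ← Functor.map_comp_assoc, Iso.hom_inv_id, CategoryTheory.Functor.map_id, Category.id_comp,
    hcap, Category.assoc, Category.assoc, Iso.hom_inv_id_assoc]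

end Related

lemma map_ev_eq_zero {g : π.ker} {φ : ρ₁.Tr g} (h : Φ.Related φ 0) (x : W) :
    Φ.P.map (ρ₁.ev φ x) = 0 := by
  rw [← cancel_mono (Φ.κ g x).hom, h x, Limits.zero_comp]
  rfl

lemma map_naturality {g : π.ker} (θ : ρ₂.Tr g) {x y : W} {t : x ⟶ (ρ₁.F g).obj ⟨x⟩}
    {t' : y ⟶ (ρ₁.F g).obj ⟨y⟩} (ht : Φ.P.map t ≫ (Φ.κ g x).hom = ρ₂.ev θ (Φ.P.obj x))
    (ht' : Φ.P.map t' ≫ (Φ.κ g y).hom = ρ₂.ev θ (Φ.P.obj y)) (f : x ⟶ y) :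
    Φ.P.map (f ≫ t') = Φ.P.map (t ≫ ρ₁.actMap g f) := by
  rw [← cancel_mono (Φ.κ g y).hom, Functor.map_comp, Functor.map_comp, Category.assoc,
    Category.assoc, ht', κ_actMap, ρ₂.ev_naturality, ← ht, Category.assoc]

lemma comp_map_ev [Φ.P.Full] {g : π.ker} (φ : ρ₁.Tr g) {x y : W}
    (f : Φ.P.obj x ⟶ Φ.P.obj y) :
    f ≫ Φ.P.map (ρ₁.ev φ y) ≫ (Φ.κ g y).hom =
      Φ.P.map (ρ₁.ev φ x) ≫ (Φ.κ g x).hom ≫ ρ₂.actMap g f := by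
  obtain ⟨f, rfl⟩ := Φ.P.map_surjective f
  rw [← Functor.map_comp_assoc, ρ₁.ev_naturality, Functor.map_comp, Category.assoc, κ_actMap]

variable [Φ.P.EssSurj]

/-- The components of the transformation `1 ⟶ ρ₂(g)` corresponding to `φ : 1 ⟶ ρ₁(g)`, obtained by
transport along `Φ.P.obj (Φ.P.objPreimage v) ≅ v`. -/
noncomputable def trMapApp {g : π.ker} (φ : ρ₁.Tr g) (v : V) : v ⟶ (ρ₂.F g).obj ⟨v⟩ :=
  (Φ.P.objObjPreimageIso v).inv ≫ Φ.P.map (ρ₁.ev φ (Φ.P.objPreimage v)) ≫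
    (Φ.κ g _).hom ≫ ρ₂.actMap g (Φ.P.objObjPreimageIso v).hom

variable [Φ.P.Full]

lemma trMapApp_naturality {g : π.ker} (φ : ρ₁.Tr g) {v w : V} (f : v ⟶ w) :
    f ≫ Φ.trMapApp φ w = Φ.trMapApp φ v ≫ ρ₂.actMap g f := by
  have h := Φ.comp_map_ev φ
    ((Φ.P.objObjPreimageIso v).hom ≫ f ≫ (Φ.P.objObjPreimageIso w).inv)
  simp only [TwistedRep.actMap_comp, Category.assoc] at h
  rw [trMapApp, trMapApp, ← cancel_epi (Φ.P.objObjPreimageIso v).hom, reassoc_of% h,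
    ← TwistedRep.actMap_comp, Iso.inv_hom_id, TwistedRep.actMap_id]
  simp only [Category.assoc, Category.comp_id, Iso.hom_inv_id_assoc]

lemma trMapApp_obj {g : π.ker} (φ : ρ₁.Tr g) (x : W) :
    Φ.trMapApp φ (Φ.P.obj x) = Φ.P.map (ρ₁.ev φ x) ≫ (Φ.κ g x).hom := by
  rw [trMapApp, ← Φ.comp_map_ev φ, Iso.inv_hom_id_assoc]

variable [Φ.P.Additive] [Φ.P.Linear k]

/-- The map of categorical traces induced by an intertwiner. -/
noncomputable def trMap (g : π.ker) : ρ₁.Tr g →ₗ[k] ρ₂.Tr g where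
  toFun φ := { app := Φ.trMapApp φ, naturality := fun _ _ f => Φ.trMapApp_naturality φ f }
  map_add' φ φ' := ρ₂.Tr_ext_of_essSurj Φ.P fun x => by
    refine (Φ.trMapApp_obj _ x).trans ?_
    rw [ρ₁.ev_add, Functor.map_add, Preadditive.add_comp, ← trMapApp_obj, ← trMapApp_obj]
    rfl
  map_smul' c φ := ρ₂.Tr_ext_of_essSurj Φ.P fun x => by
    refine (Φ.trMapApp_obj _ x).trans ?_
    rw [ρ₁.ev_smul, Functor.map_smul, Linear.smul_comp, ← trMapApp_obj]
    rfl

lemma related_trMap {g : π.ker} (φ : ρ₁.Tr g) : Φ.Related φ (Φ.trMap g φ) :=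
  fun x => (Φ.trMapApp_obj φ x).symm

lemma Related.eq_trMap {Φ : Intertwiner ρ₁ ρ₂} [Φ.P.EssSurj] [Φ.P.Full] [Φ.P.Additive]
    [Φ.P.Linear k] {g : π.ker} {φ : ρ₁.Tr g} {θ : ρ₂.Tr g} (h : Φ.Related φ θ) :
    Φ.trMap g φ = θ :=
  ρ₂.Tr_ext_of_essSurj Φ.P fun x => (Φ.related_trMap φ x).symm.trans (h x)

lemma trMap_beta {ω : G} {g g' : π.ker} (h : ω * ↑(g ^ (π ω : ℤ)) = ↑g' * ω) :
    Φ.trMap g' ∘ₗ ρ₁.beta h = ρ₂.beta h ∘ₗ Φ.trMap g :=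
  LinearMap.ext fun φ => ((Φ.related_trMap φ).beta h).eq_trMap

end Intertwiner

end Intertwiner

namespace TwistedRep

variable {G : Type*} [Group G] {π : G →* ℤˣ} {k : Type*} [CommRing k] {α : TwistedCocycle π k}
  {V : Type*} [Category* V] [Preadditive V] [Linear k V] (ρ : TwistedRep α V)

/-- The isomorphism `ρ(s) ρ(a) ≅ ρ(e) ρ(s)` for `s a = e s`. The equation `x = x'` accounts for
coordinates of an object of a product category at indices which are equal, but not by definition. -/
def exchange {s a e : G} (h : s * a = e * s) {x x' : V} (hx : x = x') :
    (ρ.F s).obj ⟨(ρ.F a).obj ⟨x⟩⟩ ≅ (ρ.F e).obj ⟨(ρ.F s).obj ⟨x'⟩⟩ :=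
  ρ.ψ s a x ≪≫ castIso ρ.F h hx ≪≫ (ρ.ψ e s x').symm

lemma exchange_rfl {s a e : G} (h : s * a = e * s) (x : V) :
    ρ.exchange h (rfl : x = x) = ρ.mu h x ≪≫ (ρ.mu (rfl : e * s = _) x).symm := by
  rw [mu_rfl, mu, Iso.trans_assoc, exchange]

lemma exchange_nat {s a e : G} (h : s * a = e * s) {δ : ℤˣ} (h₁ : δ = π s * π a)
    (h₂ : δ = π e * π s) {x y : V} (f : (⟨x⟩ : Signed δ V) ⟶ ⟨y⟩) :
    (ρ.F s).map (Signed.push (ρ.F a) h₁ f) ≫ (ρ.exchange h (rfl : y = y)).hom =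
      (ρ.exchange h (rfl : x = x)).hom ≫ (ρ.F e).map (Signed.push (ρ.F s) h₂ f) := by
  have hδ : δ = π (e * s) := by rw [h₂, map_mul]
  simp only [exchange_rfl, Iso.trans_hom, Iso.symm_hom, Category.assoc]
  rw [← Category.assoc, ρ.mu_nat h h₁ hδ f, Category.assoc]
  refine congrArg (_ ≫ ·) ?_
  rw [Iso.comp_inv_eq, Category.assoc, ρ.mu_nat rfl h₂ hδ f, Iso.inv_hom_id_assoc]

lemma exchange_nat_coord {ι : Type*} {ε : ι → ℤˣ} {γ : ℤˣ} {x y : SProd ε V}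
    (f : (⟨x⟩ : Signed γ (SProd ε V)) ⟶ ⟨y⟩) {s a e : G} (h : s * a = e * s) {i j : ι}
    (hij : i = j) (h₁ : γ * ε i = π s * π a) (h₂ : γ * ε j = π e * π s) :
    (ρ.F s).map (Signed.push (ρ.F a) h₁ (SProd.coord f i rfl)) ≫
        (ρ.exchange h (congrArg y.of hij)).hom =
      (ρ.exchange h (congrArg x.of hij)).hom ≫
        (ρ.F e).map (Signed.push (ρ.F s) h₂ (SProd.coord f j rfl)) := by
  subst hij
  exact ρ.exchange_nat h h₁ h₂ _

lemma exchange_one {s a : G} {x x' : V} (ha : a = 1) (hx : x = x') (h : s * a = 1 * s) :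
    (ρ.F s).map (Signed.iso (π s) (castIso ρ.F ha hx ≪≫ ρ.ψe x')).hom =
      (ρ.exchange h hx).hom ≫ (ρ.ψe ((ρ.F s).obj ⟨x'⟩)).hom := by
  subst ha hx
  calc (ρ.F s).map (Signed.iso (π s) (castIso ρ.F rfl rfl ≪≫ ρ.ψe x)).hom
      = (ρ.F s).map (Signed.iso (π s) (ρ.ψe x)).hom :=
        congrArg (fun e => (ρ.F s).map (Signed.iso (π s) e).hom) (Iso.refl_trans _)
    _ = (ρ.mu (mul_one s) x).hom := (ρ.mu_one_right s x).symm
    _ = (ρ.exchange h rfl).hom ≫ (ρ.mu (one_mul s) x).hom := by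
        simp [exchange, mu, castIso]
    _ = _ := by rw [ρ.mu_one_left]

lemma mu_comp_exchange {s a b c e e' : G} (hab : a * b = c) (ha : s * a = e * s)
    (hb : s * b = e' * s) (hc : s * c = e * e' * s) (x : V) :
    α.val e s b • ((ρ.F s).map (Signed.iso (π s) (ρ.mu hab x)).hom ≫
        (ρ.exchange hc (rfl : x = x)).hom) =
      (α.val s a b * α.val e e' s) • ((ρ.exchange ha rfl).hom ≫
        (ρ.F e).map (Signed.iso (π e) (ρ.exchange hb rfl)).hom ≫
          (ρ.ψ e e' ((ρ.F s).obj ⟨x⟩)).hom) := by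
  have hr : e * s * b = e * e' * s := by rw [mul_assoc, hb, mul_assoc]
  have split : (ρ.F e).map (Signed.iso (π e) (ρ.exchange hb (rfl : x = x))).hom =
      (ρ.F e).map (Signed.iso (π e) (ρ.mu hb x)).hom ≫
        (ρ.F e).map (Signed.iso (π e) (ρ.mu (rfl : e' * s = _) x)).inv := by
    rw [exchange_rfl, ← Functor.map_comp]
    rfl
  have h_sab := ρ.mu_assoc ha hab hr hc x
  have h_esb := ρ.mu_inv_comp_map_mu (rfl : e * s = _) hb hr (mul_assoc _ _ _).symm x
  have h_ees : (ρ.mu (mul_assoc e e' s).symm x).inv ≫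
      (ρ.F e).map (Signed.iso (π e) (ρ.mu (rfl : e' * s = _) x)).inv ≫ (ρ.ψ e e' _).hom =
        (α.val e e' s)⁻¹ • (ρ.mu (rfl : e * e' * s = _) x).inv := by
    rw [Iso.inv_comp_eq, Linear.comp_units_smul, ← Linear.units_smul_comp, Iso.eq_comp_inv,
      ← mu_rfl, Category.assoc]
    exact ρ.map_mu_inv_comp_mu rfl rfl rfl (mul_assoc _ _ _).symm x
  rw [split, exchange_rfl, exchange_rfl]
  simp only [Iso.trans_hom, Iso.symm_hom, Category.assoc]
  rw [reassoc_of% h_sab, reassoc_of% h_esb]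
  simp only [Linear.units_smul_comp, Linear.comp_units_smul, Category.assoc, h_ees, smul_smul]
  rw [mul_mul_mul_comm, mul_inv_cancel, mul_one, mul_comm (α.val e s b)]

lemma exchange_mul {s a b b' c e e' : G} {x x₁ x₂ x' : V}
    (hb : b = b') (hx : x = x₁) (ho : (ρ.F b).obj ⟨x⟩ = (ρ.F b').obj ⟨x₁⟩)
    (hab : a * b = c) (hx₂ : x = x₂) (hc : s * c = (e * e') * s) (hx₂' : x₂ = x')
    (ha : s * a = e * s) (hb' : s * b' = e' * s) (hx₁ : x₁ = x') (d : kˣ)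
    (hd : d * α.val s a b * α.val e e' s = α.val e s b) :
    (ρ.F s).map (d • (Signed.iso (π s) (ρ.ψ a b x ≪≫ castIso ρ.F hab hx₂)).hom) ≫
        (ρ.exchange hc hx₂').hom =
      (ρ.exchange ha ho).hom ≫ (ρ.F e).map (Signed.iso (π e) (ρ.exchange hb' hx₁)).hom ≫
        (ρ.ψ e e' ((ρ.F s).obj ⟨x'⟩)).hom := by
  subst hb hx hx₁ hx₂
  have key := ρ.mu_comp_exchange hab ha hb' hc x
  rw [← hd, mul_assoc, mul_comm d, mul_smul] at key
  rw [Functor.map_units_smul, Linear.units_smul_comp]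
  exact smul_left_cancel _ key

end TwistedRep

/-! ### The summand of the trivial coset -/

namespace SProd

variable {ι : Type*} {ε : ι → ℤˣ} {V : Type*} [Category* V] [Preadditive V]

open Classical in
/-- The morphism of the product category whose component at `i` is `t`, the other components being
zero. -/
noncomputable def single (i : ι) {x y : SProd ε V}
    (t : (⟨x.of i⟩ : Signed (ε i) V) ⟶ ⟨y.of i⟩) : x ⟶ y :=
  ⟨Function.update (fun _ => 0) i t⟩

lemma single_app_self (i : ι) {x y : SProd ε V}
    (t : (⟨x.of i⟩ : Signed (ε i) V) ⟶ ⟨y.of i⟩) : (single i t).app i = t := by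
  simp only [single, Function.update_self]

lemma single_app_of_ne {i j : ι} (h : j ≠ i) {x y : SProd ε V}
    (t : (⟨x.of i⟩ : Signed (ε i) V) ⟶ ⟨y.of i⟩) : (single i t).app j = 0 := by
  simp [single, h]

end SProd

namespace RInd

variable {G : Type*} [Group G] {π : G →* ℤˣ} {H : Subgroup G} {k : Type*} [CommRing k]
  {α : TwistedCocycle π k} {V : Type*} [Category* V] [Preadditive V] [Linear k V]
  (ρ : TwistedRep (α.res H) V) (S : CosetReps H)

/-- The trivial coset. -/
abbrev base (H : Subgroup G) : G ⧸ H := ((1 : G) : G ⧸ H)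

lemma smul_base_eq_iff (a : G) : a • base H = base H ↔ a ∈ H := by
  rw [MulAction.Quotient.smul_coe, smul_eq_mul, mul_one, eq_comm, QuotientGroup.eq, inv_one,
    one_mul]

lemma inv_smul_base (h : H) : (h : G)⁻¹ • base H = base H :=
  (smul_base_eq_iff _).mpr (inv_mem h.2)

/-- The representative of the trivial coset, as an element of the subgroup. -/
def baseRep : H := ⟨S.s (base H), by
  rw [← smul_base_eq_iff, MulAction.Quotient.smul_coe, smul_eq_mul, mul_one, S.mk_s]⟩

lemma baseRep_mul (h : H) : baseRep S * S.eta h (base H) = h * baseRep S := by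
  have h_eta := S.s_mul_eta h (base H)
  rw [inv_smul_base] at h_eta
  exact Subtype.ext h_eta

/-- The functor `∏ i, ^π(σ_i) V ⥤ V`, composed of the projection to the factor of the trivial coset
and the action of the representative of this coset. The latter makes the functor covariant, also
if the representative has degree `-1`. -/
@[simps]
def baseFunctor : Cat π S V ⥤ V where
  obj x := (ρ.F (baseRep S)).obj ⟨x.of (base H)⟩
  map f := (ρ.F (baseRep S)).map (f.app (base H))
  map_id _ := (ρ.F (baseRep S)).map_id _
  map_comp _ _ := (ρ.F (baseRep S)).map_comp _ _

lemma mapHom_baseFunctor {γ γ' : ℤˣ} {x y : Cat π S V}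
    (f : (⟨x⟩ : Signed γ (Cat π S V)) ⟶ ⟨y⟩) (h₁ : γ' = γ * π (S.s (base H)))
    (h₂ : γ' = γ * resGrading π H (baseRep S)) :
    Signed.mapHom (baseFunctor ρ S) f = Signed.push (ρ.F (baseRep S)) h₂
      (SProd.coord f (base H) h₁) := by
  ext h
  · rw [SProd.coord_pos _ _ _ h]; rfl
  · rw [SProd.coord_neg _ _ _ h]; rfl

lemma coeff_base (h₂ h₁ : H) :
    S.coeff α h₂ h₁ (base H) * α.val (baseRep S) (S.eta h₂ (base H))
      (S.eta h₁ ((h₂ : G)⁻¹ • base H)) * α.val h₂ h₁ (baseRep S) =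
      α.val h₂ (baseRep S) (S.eta h₁ ((h₂ : G)⁻¹ • base H)) := by
  rw [CosetReps.coeff, inv_smul_base h₂, inv_smul_base h₁, mul_assoc,
    mul_comm (α.val (baseRep S) _ _)]
  exact div_mul_cancel _ _

lemma baseFunctor_κ_nat (h : H) {x y : Cat π S V}
    (f : (⟨x⟩ : Signed (π h) (Cat π S V)) ⟶ ⟨y⟩) :
    (baseFunctor ρ S).map ((F ρ S h).map f) ≫
        (ρ.exchange (baseRep_mul S h) (congrArg y.of (inv_smul_base h))).hom =
      (ρ.exchange (baseRep_mul S h) (congrArg x.of (inv_smul_base h))).hom ≫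
        (ρ.F h).map (Signed.mapHom (baseFunctor ρ S) f) := by
  have hsign : π (h : G) * π (S.s ((h : G)⁻¹ • base H)) =
      resGrading π H (baseRep S) * resGrading π H (S.eta h (base H)) :=
    S.sign π h (base H)
  exact (ρ.exchange_nat_coord f (baseRep_mul S h) (inv_smul_base h) hsign rfl).trans
    (congrArg (_ ≫ (ρ.F h).map ·) (mapHom_baseFunctor ρ S f rfl rfl).symm)

/-- The functor `baseFunctor` as an intertwiner from the restriction of the induced representation
to the original one. -/
def baseIntertwiner : Intertwiner ((RInd ρ S).res H) ρ where
  P := baseFunctor ρ S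
  κ h x := ρ.exchange (baseRep_mul S h) (congrArg x.of (inv_smul_base h))
  κ_nat h _ _ f := baseFunctor_κ_nat ρ S h f
  κ_mul b a x := ρ.exchange_mul (congrArg (S.eta (a : G)) (inv_smul_base b))
    (congrArg (fun i => x.of ((a : G)⁻¹ • i)) (inv_smul_base b))
    (congrArg ((F ρ S a).obj ⟨x⟩).of (inv_smul_base b)) (S.eta_mul b a (base H))
    (congrArg x.of (CosetReps.idx_mul (b : G) a (base H))) (baseRep_mul S (b * a))
    (congrArg x.of (inv_smul_base (b * a))) (baseRep_mul S b) (baseRep_mul S a)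
    (congrArg x.of (inv_smul_base a)) _ (coeff_base S b a)
  κ_one x := ρ.exchange_one (S.eta_one (base H)) (congrArg x.of (CosetReps.idx_one (base H)))
    (baseRep_mul S 1)

instance : (baseFunctor ρ S).Additive where
  map_add := (ρ.F (baseRep S)).map_add

instance : (baseFunctor ρ S).Linear k where
  map_smul _ _ := (ρ.F (baseRep S)).map_smul _ _

lemma exists_baseFunctor_map_single {x y : Cat π S V}
    (f : (baseFunctor ρ S).obj x ⟶ (baseFunctor ρ S).obj y) :
    ∃ t : (⟨x.of (base H)⟩ : Signed (π (S.s (base H))) V) ⟶ ⟨y.of (base H)⟩,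
      (baseFunctor ρ S).map (SProd.single (base H) t) = f := by
  have surjective :=
    (ρ.F (baseRep S)).map_surjective (X := ⟨x.of (base H)⟩) (Y := ⟨y.of (base H)⟩)
  obtain ⟨t, ht⟩ := surjective f
  exact ⟨t, (congrArg (ρ.F (baseRep S)).map (SProd.single_app_self _ t)).trans ht⟩

instance : (baseFunctor ρ S).Full where
  map_surjective f := (exists_baseFunctor_map_single ρ S f).imp' (SProd.single _) fun _ => id

instance : (baseFunctor ρ S).EssSurj where
  mem_essImage v := ⟨⟨fun _ => ((ρ.F (baseRep S)).objPreimage v).of⟩,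
    ⟨(ρ.F (baseRep S)).objObjPreimageIso v⟩⟩

lemma app_base_eq_of_map_eq {x y : Cat π S V} {f f' : x ⟶ y}
    (h : (baseFunctor ρ S).map f = (baseFunctor ρ S).map f') :
    f.app (base H) = f'.app (base H) :=
  (ρ.F (baseRep S)).map_injective h

instance : (baseIntertwiner ρ S).P.Additive := inferInstanceAs (baseFunctor ρ S).Additive
instance : (baseIntertwiner ρ S).P.Linear k := inferInstanceAs ((baseFunctor ρ S).Linear k)
instance : (baseIntertwiner ρ S).P.Full := inferInstanceAs (baseFunctor ρ S).Full
instance : (baseIntertwiner ρ S).P.EssSurj := inferInstanceAs (baseFunctor ρ S).EssSurj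

variable {g : π.ker} (hg : (g : G) ∈ H)

/-- An element of degree `+1` of `G` which lies in `H`, as an element of degree `+1` of `H`. -/
abbrev toSubKer : (resGrading π H).ker := ⟨⟨g, hg⟩, g.2⟩

/-- For `g` in `H`, the map from the categorical trace of the induced representation to that of
the original one. -/
noncomputable def baseTr : (RInd ρ S).Tr g →ₗ[k] ρ.Tr (toSubKer hg) :=
  (baseIntertwiner ρ S).trMap (toSubKer hg)

lemma baseTr_beta (p : GComm π) (h : p.Mem H) :
    baseTr ρ S h.1 ∘ₗ (RInd ρ S).beta p.comm = ρ.beta (p.toSub h).comm ∘ₗ baseTr ρ S h.1 :=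
  (baseIntertwiner ρ S).trMap_beta (p.toSub h).comm

lemma related_baseTr (φ : (RInd ρ S).Tr g) :
    (baseIntertwiner ρ S).Related (g := toSubKer hg) φ (baseTr ρ S hg φ) :=
  (baseIntertwiner ρ S).related_trMap (g := toSubKer hg) φ

lemma baseTr_comp_block : baseTr ρ S hg ∘ₗ block ρ S g (base H) = baseTr ρ S hg := by
  refine LinearMap.ext fun φ => Intertwiner.Related.eq_trMap (Φ := baseIntertwiner ρ S)
    (g := toSubKer hg) (φ := block ρ S g (base H) φ) fun x => ?_
  refine Eq.trans ?_ (related_baseTr ρ S hg φ x)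
  exact congrArg (· ≫ _) (congrArg (ρ.F (baseRep S)).map (SProd.proj_app_comp_app_self _ _))

lemma block_eq_zero_of_baseTr_eq_zero {φ : (RInd ρ S).Tr g} (h : baseTr ρ S hg φ = 0) :
    block ρ S g (base H) φ = 0 := by
  refine (RInd ρ S).Tr_ext fun x => SProd.hom_ext fun i => ?_
  by_cases hi : i = base H
  · subst hi
    have h_map :=
      (baseIntertwiner ρ S).map_ev_eq_zero (h ▸ related_baseTr ρ S hg φ) x
    have h_app := app_base_eq_of_map_eq ρ S (h_map.trans ((baseFunctor ρ S).map_zero _ _).symm)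
    exact (SProd.proj_app_comp_app_self _ _).trans h_app
  · exact SProd.proj_app_comp_app_of_ne hi _

lemma baseTr_surjective : Function.Surjective (baseTr ρ S hg) := by
  intro θ
  let Φ := baseIntertwiner ρ S
  have lift (x : Cat π S V) :=
    exists_baseFunctor_map_single ρ S (y := (F ρ S g).obj ⟨x⟩)
      (ρ.ev θ (Φ.P.obj x) ≫ (Φ.κ ⟨g, hg⟩ x).inv)
  choose t ht using lift
  have ht' (x : Cat π S V) : Φ.P.map (SProd.single (base H) (t x)) ≫ (Φ.κ ⟨g, hg⟩ x).hom =
      ρ.ev θ (Φ.P.obj x) :=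
    (Iso.eq_comp_inv _).mp (ht x)
  have natural {x y : Cat π S V} (f : x ⟶ y) : f ≫ SProd.single (base H) (t y) =
      SProd.single (base H) (t x) ≫ (RInd ρ S).actMap g f := by
    refine SProd.hom_ext fun i => ?_
    by_cases hi : i = base H
    · subst hi
      exact app_base_eq_of_map_eq ρ S (Φ.map_naturality (g := toSubKer hg) θ (ht' x) (ht' y) f)
    · have left_zero := (congrArg (f.app i ≫ ·) (SProd.single_app_of_ne hi (t y))).trans
        Limits.comp_zero
      have right_zero := (congrArg (· ≫ ((RInd ρ S).actMap g f).app i)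
        (SProd.single_app_of_ne hi (t x))).trans Limits.zero_comp
      exact left_zero.trans right_zero.symm
  let φ : (RInd ρ S).Tr g :=
    { app := fun x => SProd.single (base H) (t x), naturality := fun _ _ f => natural f }
  exact ⟨φ, Intertwiner.Related.eq_trMap (Φ := Φ) (g := toSubKer hg) (φ := φ) ht'⟩

section Summands

variable {G : Type*} [Group G] {π : G →* ℤˣ} {H : Subgroup G} {k : Type*} [CommRing k]
  {α : TwistedCocycle π k} {V : Type*} [Category* V] [Preadditive V] [Linear k V]
  (ρ : TwistedRep (α.res H) V) (S : CosetReps H)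

/-- For `g` in `H`, the section of `baseTr` whose image is the summand of the trivial coset. -/
noncomputable def ofBaseTr {g : π.ker} (hg : (g : G) ∈ H) :
    ρ.Tr (toSubKer hg) →ₗ[k] (RInd ρ S).Tr g :=
  (LinearMap.ker (baseTr ρ S hg)).liftQ (block ρ S g (base H))
      (fun _ h => block_eq_zero_of_baseTr_eq_zero ρ S hg h) ∘ₗ
    ((baseTr ρ S hg).quotKerEquivOfSurjective (baseTr_surjective ρ S hg)).symm

lemma ofBaseTr_baseTr {g : π.ker} (hg : (g : G) ∈ H) (φ : (RInd ρ S).Tr g) :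
    ofBaseTr ρ S hg (baseTr ρ S hg φ) = block ρ S g (base H) φ := by
  rw [ofBaseTr, LinearMap.comp_apply, LinearEquiv.coe_coe,
    ← LinearMap.quotKerEquivOfSurjective_apply_mk _ (baseTr_surjective ρ S hg),
    LinearEquiv.symm_apply_apply]
  exact Submodule.liftQ_apply _ _ _

lemma ofBaseTr_comp_baseTr {g : π.ker} (hg : (g : G) ∈ H) :
    ofBaseTr ρ S hg ∘ₗ baseTr ρ S hg = block ρ S g (base H) :=
  LinearMap.ext (ofBaseTr_baseTr ρ S hg)

lemma baseTr_comp_ofBaseTr {g : π.ker} (hg : (g : G) ∈ H) :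
    baseTr ρ S hg ∘ₗ ofBaseTr ρ S hg = LinearMap.id := by
  rw [← LinearMap.cancel_right (baseTr_surjective ρ S hg), LinearMap.comp_assoc,
    ofBaseTr_comp_baseTr, baseTr_comp_block, LinearMap.id_comp]

lemma conj_mem_iff (p : GComm π) (σ : G) :
    (p.conj σ).Mem H ↔ (p.g : G) • σ⁻¹ • base H = σ⁻¹ • base H ∧
      p.ω • σ⁻¹ • base H = σ⁻¹ • base H := by
  have mem_iff_fixed (a : G) : σ * a * σ⁻¹ ∈ H ↔ a • σ⁻¹ • base H = σ⁻¹ • base H := by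
    rw [← smul_base_eq_iff, mul_smul, mul_smul, eq_inv_smul_iff]
  refine and_congr ((mem_iff_fixed _).trans ?_) (mem_iff_fixed p.ω)
  rcases Int.units_eq_one_or (π σ) with h | h
  · rw [h, Units.val_one, zpow_one]
  · rw [h, Units.val_neg, Units.val_one, zpow_neg_one, InvMemClass.coe_inv, inv_smul_eq_iff,
      eq_comm]

lemma fg_range_block_base {g : π.ker} (hg : (g : G) ∈ H) [Module.Finite k (ρ.Tr (toSubKer hg))] :
    (LinearMap.range (block ρ S g (base H))).FG := by
  rw [← ofBaseTr_comp_baseTr ρ S hg,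
    LinearMap.range_comp_of_range_eq_top _ (LinearMap.range_eq_top.mpr (baseTr_surjective ρ S hg))]
  exact Module.Finite.iff_fg.mp inferInstance

lemma map_beta_range_block {g g' : π.ker} {ω : G} (h : ω * (g ^ (π ω : ℤ) : π.ker) = g' * ω)
    (j : G ⧸ H) : (LinearMap.range (block ρ S g j)).map ((RInd ρ S).beta h) =
      LinearMap.range (block ρ S g' (ω • j)) := by
  rw [← LinearMap.range_comp, beta_comp_block, LinearMap.range_comp_of_range_eq_top _
    (LinearMap.range_eq_top.mpr ((RInd ρ S).beta_bijective h).surjective)]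

lemma fg_range_block [∀ h, Module.Finite k (ρ.Tr h)] (g : π.ker) (j : G ⧸ H) :
    (LinearMap.range (block ρ S g j)).FG := by
  by_cases hj : (g : G) • j = j
  · obtain ⟨σ, rfl⟩ : ∃ σ : G, j = σ⁻¹ • base H :=
      (MulAction.exists_smul_eq G (base H) j).elim fun a ha => ⟨a⁻¹, by rw [inv_inv, ha]⟩
    let p : GComm π := ⟨g, 1, by simp⟩
    have mem : (p.conj σ).Mem H := (conj_mem_iff p σ).mpr ⟨hj, one_smul _ _⟩
    have conj := TwistedRep.conj_rel p σ
    refine Submodule.fg_of_fg_map_injective _ ((RInd ρ S).beta_bijective conj).injective ?_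
    rw [map_beta_range_block, smul_inv_smul]
    exact fg_range_block_base ρ S mem.1
  · rw [block_eq_zero_of_smul_ne ρ S g hj, LinearMap.range_zero]
    exact Submodule.fg_bot

lemma finite_Tr [Finite (G ⧸ H)] [∀ h, Module.Finite k (ρ.Tr h)] (g : π.ker) :
    Module.Finite k ((RInd ρ S).Tr g) := by
  have := Fintype.ofFinite (G ⧸ H)
  have iSup_range_block : ⨆ j, LinearMap.range (block ρ S g j) = ⊤ := by
    refine eq_top_iff.mpr fun φ _ => ?_
    rw [← LinearMap.id_apply (R := k) φ, ← sum_block ρ S g, LinearMap.sum_apply]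
    exact Submodule.sum_mem _ fun j _ =>
      Submodule.mem_iSup_of_mem j (LinearMap.mem_range_self _ φ)
  exact ⟨iSup_range_block ▸ Submodule.fg_iSup _ fun j => fg_range_block ρ S g j⟩

lemma chi_eq_sum_trace_block [Fintype (G ⧸ H)] (p : GComm π) :
    (RInd ρ S).chi p =
      ∑ j, LinearMap.trace k _ ((RInd ρ S).beta p.comm ∘ₗ block ρ S p.g j) := by
  rw [← map_sum]
  refine congrArg (LinearMap.trace k _) ?_
  refine Eq.trans ?_ (Finset.mul_sum Finset.univ (block ρ S p.g)
    ((RInd ρ S).beta p.comm : Module.End k _))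
  rw [sum_block, ← Module.End.one_eq_id, mul_one]

lemma trace_beta_block_eq_zero (p : GComm π) {j : G ⧸ H} (h : p.ω • j ≠ j) :
    LinearMap.trace k _ ((RInd ρ S).beta p.comm ∘ₗ block ρ S p.g j) = 0 := by
  rw [← block_comp_self, ← LinearMap.comp_assoc, beta_comp_block]
  refine (LinearMap.trace_mul_comm k (block ρ S p.g (p.ω • j) ∘ₗ (RInd ρ S).beta p.comm)
    (block ρ S p.g j)).trans ?_
  rw [Module.End.mul_eq_comp, ← LinearMap.comp_assoc, block_comp_of_ne ρ S p.g h.symm,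
    LinearMap.zero_comp, map_zero]

lemma trace_beta_block_eq_zero_of_not_mem (p : GComm π) {σ : G} (h : ¬(p.conj σ).Mem H) :
    LinearMap.trace k _ ((RInd ρ S).beta p.comm ∘ₗ block ρ S p.g (σ⁻¹ • base H)) = 0 := by
  rcases not_and_or.mp ((conj_mem_iff p σ).not.mp h) with hg | hω
  · rw [block_eq_zero_of_smul_ne ρ S p.g hg, LinearMap.comp_zero, map_zero]
  · exact trace_beta_block_eq_zero ρ S p hω

lemma trace_beta_block_conj (p : GComm π) (σ : G) (j : G ⧸ H) :
    LinearMap.trace k _ ((RInd ρ S).beta (p.conj σ).comm ∘ₗ block ρ S (p.conj σ).g (σ • j)) =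
      α.tautau σ p •
        LinearMap.trace k _ ((RInd ρ S).beta p.comm ∘ₗ block ρ S p.g j) := by
  let b := (RInd ρ S).beta (TwistedRep.conj_rel p σ)
  let e := LinearEquiv.ofBijective b ((RInd ρ S).beta_bijective (TwistedRep.conj_rel p σ))
  have conj_comp (f : Module.End k ((RInd ρ S).Tr p.g)) : e.conj f ∘ₗ b = b ∘ₗ f :=
    LinearMap.ext fun φ => congrArg (fun φ => b (f φ)) (e.symm_apply_apply φ)
  rw [← LinearMap.trace_conj' _ e, ← LinearMap.map_smul_of_tower]
  refine congrArg (LinearMap.trace k _) ((LinearMap.cancel_right e.surjective).mp ?_)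
  calc ((RInd ρ S).beta (p.conj σ).comm ∘ₗ block ρ S (p.conj σ).g (σ • j)) ∘ₗ b
      = ((RInd ρ S).beta (p.conj σ).comm ∘ₗ b) ∘ₗ block ρ S p.g j := by
        rw [LinearMap.comp_assoc, LinearMap.comp_assoc, beta_comp_block]
    _ = (α.tautau σ p • (b ∘ₗ (RInd ρ S).beta p.comm)) ∘ₗ block ρ S p.g j := by
        rw [(RInd ρ S).beta_conj_comp p σ]
    _ = (α.tautau σ p • e.conj ((RInd ρ S).beta p.comm ∘ₗ block ρ S p.g j)) ∘ₗ b := by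
        rw [LinearMap.smul_comp, LinearMap.smul_comp, conj_comp, LinearMap.comp_assoc]

lemma trace_beta_block_base (p : GComm π) (h : p.Mem H)
    [Module.Free k ((RInd ρ S).Tr p.g)] [Module.Finite k ((RInd ρ S).Tr p.g)]
    [Module.Free k (ρ.Tr (toSubKer h.1))] [Module.Finite k (ρ.Tr (toSubKer h.1))] :
    LinearMap.trace k _ ((RInd ρ S).beta p.comm ∘ₗ block ρ S p.g (base H)) =
      ρ.chi (p.toSub h) := by
  rw [← ofBaseTr_comp_baseTr ρ S h.1, ← LinearMap.comp_assoc, LinearMap.trace_comp_comm',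
    ← LinearMap.comp_assoc, baseTr_beta ρ S p h]
  exact congrArg (LinearMap.trace k _) ((LinearMap.comp_assoc _ _ _).trans
    ((congrArg (_ ∘ₗ ·) (baseTr_comp_ofBaseTr ρ S h.1)).trans (LinearMap.comp_id _)))

lemma trace_beta_block (p : GComm π) {σ : G} (h : (p.conj σ).Mem H)
    [Module.Free k ((RInd ρ S).Tr (p.conj σ).g)] [Module.Finite k ((RInd ρ S).Tr (p.conj σ).g)]
    [Module.Free k (ρ.Tr (toSubKer h.1))] [Module.Finite k (ρ.Tr (toSubKer h.1))] :
    LinearMap.trace k _ ((RInd ρ S).beta p.comm ∘ₗ block ρ S p.g (σ⁻¹ • base H)) =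
      (((α.tautau σ p)⁻¹ : kˣ) : k) * ρ.chi ((p.conj σ).toSub h) := by
  rw [← trace_beta_block_base ρ S, ← smul_eq_mul, ← Units.smul_def, eq_inv_smul_iff,
    ← trace_beta_block_conj, smul_inv_smul]

end Summands

section Counting

variable {G : Type*} [Group G]

lemma sum_inv_smul_base [Fintype G] (H : Subgroup G) [Fintype (G ⧸ H)] {M : Type*}
    [AddCommMonoid M] (f : G ⧸ H → M) :
    ∑ σ : G, f (σ⁻¹ • base H) = Nat.card H • ∑ j, f j := by
  have := Fintype.ofFinite H
  calc ∑ σ : G, f (σ⁻¹ • base H)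
      = ∑ σ : G, f (σ : G ⧸ H) := Fintype.sum_equiv (Equiv.inv G) _ _ fun σ => by
        rw [Equiv.inv_apply, MulAction.Quotient.smul_coe, smul_eq_mul, mul_one]
    _ = ∑ q : (G ⧸ H) × H, f q.1 :=
        Fintype.sum_equiv Subgroup.groupEquivQuotientProdSubgroup _ _ fun _ => rfl
    _ = Nat.card H • ∑ j, f j := by
        rw [Fintype.sum_prod_type, Finset.smul_sum]
        simp only [Finset.sum_const, Finset.card_univ, Nat.card_eq_fintype_card]

lemma card_eq_two_mul_card_ker {π : G →* ℤˣ} (hπ : Function.Surjective π) :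
    Nat.card G = 2 * Nat.card π.ker := by
  rw [← π.ker.card_mul_index, Subgroup.index_ker, MonoidHom.range_eq_top.mpr hπ,
    Subgroup.card_top, Nat.card_eq_fintype_card (α := ℤˣ), Fintype.card_units_int, mul_comm]

end Counting

end RInd

end Real2

theorem mainTheorem3_general {G : Type*} [Group G] [Fintype G] {π : G →* ℤˣ} {H : Subgroup G}
    {k : Type*} [CommRing k] {α : Real2.TwistedCocycle π k}
    {V : Type*} [Category* V] [Preadditive V] [Linear k V]
    (ρ : Real2.TwistedRep (α.res H) V) (S : Real2.CosetReps H)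
    [∀ h, Module.Finite k (ρ.Tr h)] [∀ h, Module.Free k (ρ.Tr h)]
    [∀ g, Module.Free k ((Real2.RInd ρ S).Tr g)] :
    (∀ g, Module.Finite k ((Real2.RInd ρ S).Tr g)) ∧
      ∀ p : Real2.GComm π, (Nat.card H : k) * (Real2.RInd ρ S).chi p =
        ∑ σ : {σ : G // (p.conj σ).Mem H},
          (((α.tautau σ p)⁻¹ : kˣ) : k) * ρ.chi ((p.conj σ).toSub σ.2) := by
  have finite := Real2.RInd.finite_Tr ρ S
  have := Fintype.ofFinite (G ⧸ H)
  refine ⟨finite, fun p => ?_⟩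
  rw [Real2.RInd.chi_eq_sum_trace_block, ← nsmul_eq_mul, ← Real2.RInd.sum_inv_smul_base]
  refine (Fintype.sum_of_injective _ Subtype.val_injective _ _ (fun σ hσ => ?_) fun σ => ?_).symm
  · exact Real2.RInd.trace_beta_block_eq_zero_of_not_mem ρ S p fun h => hσ ⟨⟨σ, h⟩, rfl⟩
  · exact (Real2.RInd.trace_beta_block ρ S p σ.2).symm

theorem mainTheorem3 {G : Type*} [Group G] [Fintype G] (π : G →* ℤˣ)
    (H : Subgroup G) (hH : Function.Surjective (Real2.resGrading π H))
    {k : Type*} [Field k] (α : Real2.TwistedCocycle π k)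
    {V : Type*} [Category* V] [Preadditive V] [Linear k V]
    (ρ : Real2.TwistedRep (α.res H) V) (S : Real2.CosetReps H)
    (hρ : ∀ h, FiniteDimensional k (ρ.Tr h))
    (hk : (2 * Nat.card (Real2.resGrading π H).ker : k) ≠ 0) :
    (∀ g, FiniteDimensional k ((Real2.RInd ρ S).Tr g)) ∧
      ∀ p : Real2.GComm π, (Real2.RInd ρ S).chi p =
        (2 * Nat.card (Real2.resGrading π H).ker : k)⁻¹ *
          ∑ σ : {σ : G // (p.conj σ).Mem H},
            (((α.tautau σ p)⁻¹ : kˣ) : k) * ρ.chi ((p.conj σ).toSub σ.2) := by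
  have card_H : (Nat.card H : k) = 2 * Nat.card (Real2.resGrading π H).ker := by
    rw [Real2.RInd.card_eq_two_mul_card_ker hH, Nat.cast_mul, Nat.cast_two]
  refine (mainTheorem3_general ρ S).imp_right fun h p => ?_
  rw [← h p, card_H, inv_mul_cancel_left₀ hk]
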